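/- **Setting.** All vector spaces are real. For integers $s\ge 0$ and $0\le l\le 2s$ let $X_{s,l}$ be the graded symplectic space with basis $e_s,e_{s-1},\dots,e_{s-l}$, $f_{l-s},f_{l-s-1},\dots,f_{-s}$ (the index is the degree), where $\sigma(e_j,f_{-j})=(-1)^{s-j}$ and all other products of basis vectors vanish up to skew symmetry, and let $\delta_{s,l}$ be the degree $-1$ endomorphism $e_j\mapsto e_{j-1}$, $f_j\mapsto f_{j-1}$ (with $e_{s-l}\mapsto 0$, $f_{-s}\mapsto 0$). For half-integer $s>0$ define $\delta_{s,0}$ in the same way. For a positive half-integer $m\in\frac12\mathbb Z\setminus\mathbb Z$ let $\mathcal L_m$ have the basis $\varepsilon_m,\varepsilon_{m-1},\dots,\varepsilon_{-m}$ with $\sigma(\varepsilon_j,\varepsilon_{-j})=(-1)^{m-j}$ and all other products zero, and let $\tau_m:\varepsilon_j\mapsto\varepsilon_{j-1}$, $\varepsilon_{-m}\mapsto 0$. Let $X=\bigoplus_j X^j$ be a graded symplectic space (with $j\in\frac12\mathbb Z$, $\sigma(X^i,X^j)=0$ for $i+j\ne 0$, and $\sigma$ regarded up to a nonzero factor) and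 let $\delta_{\rm mod}$ be a line of degree $-1$ endomorphisms of $X$ (a modified Jacobi symbol) spanned by an orthogonal direct sum of $r$ endomorphisms $\delta_{s_i,l_i}$ and of $t\in\{0,1\}$ endomorphisms $\tau_m$. Fix such a decomposition. Its skew Young diagram has the rows $(e_{s_i},\dots,e_{s_i-l_i})$, $(f_{l_i-s_i},\dots,f_{-s_i})$, $1\le i\le r$, and $(\varepsilon_m,\dots,\varepsilon_{-m})$ if $t=1$; boxes of equal degree lie in one column and the degree decreases from left to right. Let $\mathfrak{csp}(X)=\{A:\exists c\ \forall v,w\ \ \sigma(Av,w)+\sigma(v,Aw)=c\,\sigma(v,w)\}$, and let $\mathfrak{csp}^k(X)$ be its part of degree $k$. Put $\mathfrak u^F(\delta_{\rm mod})=\bigoplus_{k\ge -1}\mathfrak u^F_k$, $k\in\frac12\mathbb Z$, with $\mathfrak u^F_{-1}=\delta_{\rm mod}$, $\mathfrak u^F_{-1/2}=0$ and $\mathfrak u^F_k=\{A\in\mathfrak{csp}^k(X):[A,\delta_{\rm mod}]\subset\mathfrak u^F_{k-1}\}$ for $k\ge 0$. Let $\eta=\eta^{-1}\oplus\eta^{-2}$,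 $\eta^{-1}=X$, $\eta^{-2}=\mathbb R y$, be the Heisenberg algebra, $[v,w]=\sigma(v,w)y$. Its Tanaka prolongations are $\mathfrak u^j=\eta^j$ for $j<0$, $\mathfrak u^0=\mathfrak u^F(\delta_{\rm mod})$ (acting on $\eta$ by derivations of degree $0$) and, for $k>0$, $\mathfrak u^k=\mathfrak u^k(\eta,\mathfrak u^F(\delta_{\rm mod}))=\{f\in\mathrm{Hom}(\eta^{-1},\mathfrak u^{k-1})\oplus\mathrm{Hom}(\eta^{-2},\mathfrak u^{k-2}): f([a,b])=[f(a),b]+[a,f(b)]\ \forall a,b\in\eta\}$, where $[f,a]=-[a,f]=f(a)$ for $a\in\eta$ and $f$ of nonnegative degree. Let $X_{j_0}$ be the sum of all $X^j$ with $j>0$. For $1\le i\le r$ let $\mathfrak L_i=X_{j_0}$ if $l_i=2s_i$ (the two rows of $\delta_{s_i,l_i}$ form a rectangle), and $\mathfrak L_i=X_{j_0}\oplus\mathbb R e_0$ with $e_0$ taken from the $i$-th component otherwise; if $t=1$, put also $\mathfrak L_{r+1}=X_{j_0}$. Let $\mathcal E_i(\delta_{\rm mod})\subset\mathbb PX$ be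 the Zariski closure of the union over $x\in\delta_{\rm mod}$ of the sets of lines contained in $e^x\mathfrak L_i$. For $\mathcal E\subset\mathbb PX$ let $S^k\mathcal E$ be the $k$-th secant variety, that is, the Zariski closure of the union of the projective spans of all $k+1$ points of $\mathcal E$, and let $\mathcal I_n(\mathcal E)$ be the space of homogeneous polynomials of degree $n$ on $X$ that vanish on $\mathcal E$. **Theorem.** Assume that the skew Young diagram of $\delta_{\rm mod}$ satisfies the following conditions: (1) it does not contain two rows such that the leftmost box of one of them lies in the same column as, or to the right of, the rightmost box of the other; (2) it does not consist of one row with two boxes; (3) every row with integer degrees has at least $4$ boxes; (4) the row with degrees in $\frac12\mathbb Z\setminus\mathbb Z$, if it exists, has at least $6$ boxes. Let $1\le i\le r+t$. Then for every integer $k\ge 1$ the linear map that sends $f\in\mathfrak u^k(\eta,\mathfrak u^F(\delta_{\rm mod}))$ to the polynomial $$v\longmapsto\sigma\bigl(v,[\dots[[f,v],v]\dots,v]\bigr)\qquad(k+1\text{ brackets})$$ is an injection of $\mathfrak u^k(\eta,\mathfrak u^F(\delta_{\rm mod}))$ into $\mathcal I_{k+2}\bigl(S^k\mathcal E_i(\delta_{\rm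 mod})\bigr)$; in particular $\dim\mathfrak u^k(\eta,\mathfrak u^F(\delta_{\rm mod}))\le\dim\mathcal I_{k+2}\bigl(S^k\mathcal E_i(\delta_{\rm mod})\bigr)<\infty$. Moreover there is $K$ such that $S^k\mathcal E_i(\delta_{\rm mod})=\mathbb PX$ and $\mathfrak u^k(\eta,\mathfrak u^F(\delta_{\rm mod}))=0$ for all $k\ge K$. -/

import Mathlib

universe u

/-!
All degrees lie in `(1/2)ℤ`; a degree `i` is stored as the integer `2 * i`.
-/

/-! ### Skew Young diagrams and tableaux of modified Jacobi symbols -/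

/-- The isomorphism type of a modified Jacobi symbol: a direct sum of `r` symbols
`ℝ δ_{s_i, l_i}` and of at most one symbol `ℝ τ_m`.  Here `S i = 2 s_i` and `M = 2 m`.
Components `δ_{s, l}` with `s` an integer satisfy `0 ≤ l ≤ 2 s`; those with `s` in
`(1/2)ℤ ∖ ℤ` occur only as the components `δ_{s, 0}` added when passing to the modified symbol. -/
structure JacobiDiagram where
  r : ℕ
  S : Fin r → ℕ
  l : Fin r → ℕ
  l_le : ∀ i, l i ≤ S i
  half : ∀ i, Odd (S i) → l i = 0
  t : ℕ
  t_le : t ≤ 1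
  M : Fin t → ℕ
  M_odd : ∀ i, Odd (M i)

namespace JacobiDiagram

/-- The rows of the diagram: the two rows of each `δ_{s_i, l_i}` (upper row `inl (inl i)`, with
entries `e`, lower row `inl (inr i)`, with entries `f`), and the row of `τ_m`. -/
abbrev Row (D : JacobiDiagram) : Type := (Fin D.r ⊕ Fin D.r) ⊕ Fin D.t

/-- The number of boxes in a row. -/
def len (D : JacobiDiagram) : D.Row → ℕ
  | .inl (.inl i) => D.l i + 1
  | .inl (.inr i) => D.l i + 1
  | .inr i => D.M i + 1

/-- Twice the degree of the leftmost box of a row: degrees `s`, `l - s`, `m`. -/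
def top (D : JacobiDiagram) : D.Row → ℤ
  | .inl (.inl i) => D.S i
  | .inl (.inr i) => 2 * D.l i - D.S i
  | .inr i => D.M i

/-- Twice the degree of the rightmost box of a row. -/
def bot (D : JacobiDiagram) (a : D.Row) : ℤ := D.top a - 2 * ((D.len a : ℤ) - 1)

/-- The boxes; `⟨a, j⟩` is the box number `j` (counted from the left, from `0`) of the row `a`. -/
abbrev Box (D : JacobiDiagram) : Type := Σ a : D.Row, Fin (D.len a)

/-- Twice the degree of a box; columns are indexed by degrees, decreasing from left to right. -/
def deg (D : JacobiDiagram) (b : D.Box) : ℤ := D.top b.1 - 2 * (b.2 : ℕ)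

/-- The symplectic products of the entries of a tableau: `σ(e_j, f_{-j}) = (-1)^(s - j)`,
`σ(ε_j, ε_{-j}) = (-1)^(m - j)`, all others (up to skew symmetry) vanish. -/
def pairing (D : JacobiDiagram) : D.Box → D.Box → ℤ
  | ⟨.inl (.inl i), j⟩, ⟨.inl (.inr i'), j'⟩ =>
      if i = i' ∧ (j : ℕ) + (j' : ℕ) = D.l i then (-1) ^ (j : ℕ) else 0
  | ⟨.inl (.inr i'), j'⟩, ⟨.inl (.inl i), j⟩ =>
      if i = i' ∧ (j : ℕ) + (j' : ℕ) = D.l i then -(-1) ^ (j : ℕ) else 0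
  | ⟨.inr i, j⟩, ⟨.inr i', j'⟩ =>
      if i = i' ∧ (j : ℕ) + (j' : ℕ) = D.M i then (-1) ^ (j : ℕ) else 0
  | _, _ => 0

/-- The subdiagram of the two rows of `δ_{s_i, l_i}` is a rectangle, that is, `l_i = 2 s_i`. -/
def Rectangular (D : JacobiDiagram) (i : Fin D.r) : Prop := D.l i = D.S i

/-- No row has its leftmost box in the same column as, or to the right of, the rightmost box of
another row. -/
def Cond1 (D : JacobiDiagram) : Prop :=
  ∀ a b : D.Row, a ≠ b → ¬ D.top b ≤ D.bot a

/-- The diagram does not consist of one row with two boxes. -/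
def Cond2 (D : JacobiDiagram) : Prop :=
  ¬ ∃ a : D.Row, (∀ b : D.Row, b = a) ∧ D.len a = 2

/-- Every row indexed by integers has at least four boxes. -/
def Cond3 (D : JacobiDiagram) : Prop := ∀ a : D.Row, Even (D.top a) → 4 ≤ D.len a

/-- A row indexed by `(1/2)ℤ ∖ ℤ` has at least six boxes. -/
def Cond4 (D : JacobiDiagram) : Prop := ∀ a : D.Row, Odd (D.top a) → 6 ≤ D.len a

end JacobiDiagram

section FlagSymbols

variable {X : Type u} [AddCommGroup X] [Module ℝ X]

/-- `(X, σ, G)` is a graded (conformal) symplectic space with a chosen representative `σ` of the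
conformal class; `G j` is the component of degree `j / 2`. -/
structure IsGradedSymplectic (σ : LinearMap.BilinForm ℝ X) (G : ℤ → Submodule ℝ X) : Prop where
  alt : σ.IsAlt
  nondegenerate : σ.Nondegenerate
  internal : DirectSum.IsInternal G
  orthogonal : ∀ i j : ℤ, i + j ≠ 0 → ∀ x ∈ G i, ∀ y ∈ G j, σ x y = 0

/-- A skew Young tableau of shape `D` of the symplectic flag symbol `δ` (a line of endomorphisms)
on the graded symplectic space `(X, σ, G)`: the boxes are filled with a homogeneous basis having
the prescribed symplectic products, and a generator of the line `δ` acts as the right shift. -/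
structure SkewTableau (D : JacobiDiagram) (σ : LinearMap.BilinForm ℝ X) (G : ℤ → Submodule ℝ X)
    (δ : Submodule ℝ (Module.End ℝ X)) where
  basis : Module.Basis D.Box ℝ X
  basis_mem : ∀ b, basis b ∈ G (D.deg b)
  pairing_eq : ∀ b c, σ (basis b) (basis c) = (D.pairing b c : ℝ)
  gen : Module.End ℝ X
  gen_span : δ = Submodule.span ℝ {gen}
  gen_basis : ∀ b : D.Box, gen (basis b) =
    if h : (b.2 : ℕ) + 1 < D.len b.1 then basis ⟨b.1, ⟨(b.2 : ℕ) + 1, h⟩⟩ else 0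

/-- The conformal symplectic algebra. -/
def csp (σ : LinearMap.BilinForm ℝ X) : Submodule ℝ (Module.End ℝ X) where
  carrier := {A | ∃ c : ℝ, ∀ v w, σ (A v) w + σ v (A w) = c * σ v w}
  zero_mem' := ⟨0, fun v w => by simp⟩
  add_mem' := by
    rintro A B ⟨a, ha⟩ ⟨b, hb⟩
    refine ⟨a + b, fun v w => ?_⟩
    have h1 := ha v w
    have h2 := hb v w
    simp only [LinearMap.add_apply, map_add]
    linarith
  smul_mem' := by
    rintro t A ⟨a, ha⟩
    refine ⟨t * a, fun v w => ?_⟩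
    have h1 := ha v w
    simp only [LinearMap.smul_apply, map_smul, smul_eq_mul]
    rw [← mul_add, h1, mul_assoc]

/-- Endomorphisms of degree `j / 2`. -/
def endGr (G : ℤ → Submodule ℝ X) (j : ℤ) : Submodule ℝ (Module.End ℝ X) where
  carrier := {A | ∀ i, ∀ x ∈ G i, A x ∈ G (i + j)}
  zero_mem' := fun i x _ => by simp
  add_mem' := fun hA hB i x hx => (G (i + j)).add_mem (hA i x hx) (hB i x hx)
  smul_mem' := fun c _ hA i x hx => (G (i + j)).smul_mem c (hA i x hx)

/-- The endomorphisms `A` with `[A, x] ∈ W` for all `x` in the line `δ`. -/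
def bracketInto (δ W : Submodule ℝ (Module.End ℝ X)) : Submodule ℝ (Module.End ℝ X) where
  carrier := {A | ∀ x ∈ δ, A * x - x * A ∈ W}
  zero_mem' := fun x _ => by simp
  add_mem' := fun hA hB x hx => by
    rw [add_mul, mul_add, add_sub_add_comm]
    exact W.add_mem (hA x hx) (hB x hx)
  smul_mem' := fun c _ hA x hx => by
    rw [smul_mul_assoc, mul_smul_comm, ← smul_sub]
    exact W.smul_mem c (hA x hx)

/-- The algebraic prolongations of the symbol `δ` in the conformal symplectic algebra:
`flagProlong σ G δ n` is the component of degree `n / 2 - 1`.  So the component of degree `-1`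
is `δ`, the one of degree `-1/2` is `0`, and for `k ≥ 0` the one of degree `k` consists of the
`A ∈ csp^k` with `[A, δ]` in the one of degree `k - 1`. -/
def flagProlong (σ : LinearMap.BilinForm ℝ X) (G : ℤ → Submodule ℝ X)
    (δ : Submodule ℝ (Module.End ℝ X)) : ℕ → Submodule ℝ (Module.End ℝ X)
  | 0 => δ
  | 1 => ⊥
  | n + 2 => csp σ ⊓ endGr G (n : ℤ) ⊓ bracketInto δ (flagProlong σ G δ n)

/-- The universal algebraic prolongation of the symbol `δ` in the conformal symplectic algebra. -/
def uF (σ : LinearMap.BilinForm ℝ X) (G : ℤ → Submodule ℝ X)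
    (δ : Submodule ℝ (Module.End ℝ X)) : Submodule ℝ (Module.End ℝ X) :=
  ⨆ n : ℕ, flagProlong σ G δ n

/-- The exponential of a nilpotent endomorphism. -/
noncomputable def expNilpotent (x : Module.End ℝ X) : Module.End ℝ X :=
  ∑ j ∈ Finset.range (nilpotencyClass x), ((j.factorial : ℝ)⁻¹) • x ^ j

/-- `X_{j₀}`, where `j₀` is the smallest positive index of the grading: the sum of all components
of positive degree. -/
def positivePart (G : ℤ → Submodule ℝ X) : Submodule ℝ X := ⨆ j : ℤ, ⨆ _ : 0 < j, G j

open Classical in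
/-- The spaces `𝔏_i`; the index `inl i` stands for `1 ≤ i ≤ r`, and `inr` for `r + 1`, which is
present exactly if there is a row of type `τ_m`.  The space is the sum of `X_{j₀}` and of the line
of `e_0` if the two rows of the component number `i` do not form a rectangle, and is `X_{j₀}` in
the other cases. -/
noncomputable def SkewTableau.frakL {D : JacobiDiagram} {σ : LinearMap.BilinForm ℝ X}
    {G : ℤ → Submodule ℝ X} {δ : Submodule ℝ (Module.End ℝ X)} (T : SkewTableau D σ G δ) :
    Fin D.r ⊕ Fin D.t → Submodule ℝ X
  | .inl i =>
      if D.Rectangular i then positivePart G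
      else positivePart G ⊔ Submodule.span ℝ
        {x | ∃ j : Fin (D.len (.inl (.inl i))), D.deg ⟨.inl (.inl i), j⟩ = 0 ∧
          x = T.basis ⟨.inl (.inl i), j⟩}
  | .inr _ => positivePart G

end FlagSymbols

/-! ### Polynomials on `X` and projective varieties in `ℙ X` -/

section Varieties

variable (X : Type u) [AddCommGroup X] [Module ℝ X]

/-- The homogeneous polynomials of degree `n` on `X`: the functions `v ↦ m (v, …, v)` for an
`n`-linear form `m`. -/
def homPoly (n : ℕ) : Submodule ℝ (X → ℝ) where
  carrier := {F | ∃ m : MultilinearMap ℝ (fun _ : Fin n => X) ℝ, ∀ v, F v = m (fun _ => v)}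
  zero_mem' := ⟨0, fun v => by simp⟩
  add_mem' := by
    rintro F H ⟨a, ha⟩ ⟨b, hb⟩
    exact ⟨a + b, fun v => by simp [ha, hb]⟩
  smul_mem' := by
    rintro c F ⟨a, ha⟩
    exact ⟨c • a, fun v => by simp [ha]⟩

variable {X}

/-- The Zariski closure of a set of points in the real projective space of `X`. -/
def zariskiClosure (E : Set (Projectivization ℝ X)) : Set (Projectivization ℝ X) :=
  {p | ∀ n : ℕ, ∀ F ∈ homPoly X n, (∀ q ∈ E, F q.rep = 0) → F p.rep = 0}

/-- `𝓘_n(E)`: the homogeneous polynomials of degree `n` on `X` that vanish on `E`. -/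
def vanishingForms (n : ℕ) (E : Set (Projectivization ℝ X)) : Submodule ℝ (X → ℝ) where
  carrier := {F | F ∈ homPoly X n ∧ ∀ p ∈ E, F p.rep = 0}
  zero_mem' := ⟨(homPoly X n).zero_mem, fun p _ => rfl⟩
  add_mem' := fun hF hH => ⟨(homPoly X n).add_mem hF.1 hH.1, fun p hp => by
    simp [hF.2 p hp, hH.2 p hp]⟩
  smul_mem' := fun c _ hF => ⟨(homPoly X n).smul_mem c hF.1, fun p hp => by
    simp [hF.2 p hp]⟩

/-- The `k`-th secant variety of `E`: the Zariski closure of the union of the projective spans of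
all `(k + 1)`-tuples of points of `E`. -/
def secantVariety (k : ℕ) (E : Set (Projectivization ℝ X)) : Set (Projectivization ℝ X) :=
  zariskiClosure {p | ∃ q : Fin (k + 1) → Projectivization ℝ X,
    (∀ j, q j ∈ E) ∧ p.submodule ≤ ⨆ j, (q j).submodule}

/-- `𝓔_i`: the Zariski closure of the union of all lines contained in one of the spaces
`e^x 𝔏_i`, `x ∈ δ`. -/
noncomputable def SkewTableau.orbitVariety {D : JacobiDiagram} {σ : LinearMap.BilinForm ℝ X}
    {G : ℤ → Submodule ℝ X} {δ : Submodule ℝ (Module.End ℝ X)} (T : SkewTableau D σ G δ)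
    (i : Fin D.r ⊕ Fin D.t) : Set (Projectivization ℝ X) :=
  zariskiClosure {p | ∃ x ∈ δ, p.submodule ≤ (T.frakL i).map (expNilpotent x)}

end Varieties

/-! ### Tanaka prolongation of a subspace of `csp (X)` over the Heisenberg algebra

The Heisenberg algebra is `η = η⁻¹ ⊕ η⁻²` with `η⁻¹ = X`, `η⁻² = ℝ y`, `[v, w] = σ(v, w) y`.
A linear map of degree `k` on `η` is written as a pair: its restriction to `X` and its value at
`y`. -/

section Tanaka

/-- The graded pieces of the ambient space: `ambient X n` is the piece of degree `n - 1`.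
Degree `-1` is `X`; degree `0` is `Hom(X, X) ⊕ Hom(η⁻², η⁻²)`, where a scalar `c` stands for
`y ↦ c y`; degree `k ≥ 1` is `Hom(η⁻¹, degree k - 1) ⊕ Hom(η⁻², degree k - 2)`. -/
noncomputable def ambient (X : Type u) [AddCommGroup X] [Module ℝ X] : ℕ → ModuleCat.{u} ℝ
  | 0 => ModuleCat.of ℝ X
  | 1 => ModuleCat.of ℝ ((X →ₗ[ℝ] X) × ℝ)
  | n + 2 => ModuleCat.of ℝ ((X →ₗ[ℝ] ambient X (n + 1)) × ambient X n)

variable {X : Type u} [AddCommGroup X] [Module ℝ X]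

/-- The restriction to `X = η⁻¹` of an element of degree `n`, that is, `f ↦ (v ↦ [f, v])`. -/
noncomputable def onX : (n : ℕ) → ambient X (n + 1) →ₗ[ℝ] (X →ₗ[ℝ] ambient X n)
  | 0 => LinearMap.fst ℝ (X →ₗ[ℝ] X) ℝ
  | n + 1 => LinearMap.fst ℝ (X →ₗ[ℝ] ambient X (n + 1)) (ambient X n)

/-- The value at `y` of an element of degree `n + 1`, that is, `f ↦ [f, y]`. -/
noncomputable def onY (n : ℕ) : ambient X (n + 2) →ₗ[ℝ] ambient X n :=
  LinearMap.snd ℝ (X →ₗ[ℝ] ambient X (n + 1)) (ambient X n)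

/-- The scalar `c` with `[f, y] = c y` for an element `f` of degree `0`. -/
noncomputable def scaleY : ambient X 1 →ₗ[ℝ] ℝ := LinearMap.snd ℝ (X →ₗ[ℝ] X) ℝ

/-- An element of degree `-1`, as a vector. -/
noncomputable def asVector : ambient X 0 →ₗ[ℝ] X := LinearMap.id

/-- The elements of degree `0` that are derivations of `η` with restriction to `X` in `g`. -/
noncomputable def degZero (σ : LinearMap.BilinForm ℝ X) (g : Submodule ℝ (Module.End ℝ X)) :
    Submodule ℝ (ambient X 1) where
  carrier := {f | asVector ∘ₗ onX 0 f ∈ g ∧ ∀ v w : X,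
    σ v w * scaleY f = σ (asVector (onX 0 f v)) w + σ v (asVector (onX 0 f w))}
  zero_mem' := ⟨by simp, fun v w => by simp⟩
  add_mem' := by
    rintro f f' ⟨h1, h2⟩ ⟨h3, h4⟩
    refine ⟨?_, fun v w => ?_⟩
    · rw [map_add, LinearMap.comp_add]
      exact g.add_mem h1 h3
    · simp only [map_add, LinearMap.add_apply, mul_add, h2, h4]
      ring
  smul_mem' := by
    rintro c f ⟨h1, h2⟩
    refine ⟨?_, fun v w => ?_⟩
    · rw [map_smul, LinearMap.comp_smul]
      exact g.smul_mem c h1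
    · simp only [map_smul, LinearMap.smul_apply, smul_eq_mul, mul_left_comm _ c, h2]
      ring

/-- The elements `f` of degree `1` that map `X` into `U₀` (in degree `0`) and satisfy
`f([a, b]) = [f a, b] + [a, f b]` for `(a, b) = (v, w)` and `(a, b) = (v, y)`, with `v, w ∈ X`. -/
noncomputable def degOne (σ : LinearMap.BilinForm ℝ X) (U₀ : Submodule ℝ (ambient X 1)) :
    Submodule ℝ (ambient X 2) where
  carrier := {f | (∀ v : X, onX 1 f v ∈ U₀) ∧
    (∀ v w : X, σ v w • onY 0 f = onX 0 (onX 1 f v) w - onX 0 (onX 1 f w) v) ∧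
    ∀ v : X, 0 = scaleY (onX 1 f v) + σ v (asVector (onY 0 f))}
  zero_mem' := ⟨fun v => by simp, fun v w => by simp, fun v => by simp⟩
  add_mem' := by
    rintro f f' ⟨h1, h2, h3⟩ ⟨k1, k2, k3⟩
    refine ⟨fun v => ?_, fun v w => ?_, fun v => ?_⟩
    · simp only [map_add, LinearMap.add_apply]
      exact U₀.add_mem (h1 v) (k1 v)
    · simp only [map_add, LinearMap.add_apply, smul_add, h2, k2]
      abel
    · simp only [map_add, LinearMap.add_apply]
      linarith [h3 v, k3 v]
  smul_mem' := by
    rintro c f ⟨h1, h2, h3⟩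
    refine ⟨fun v => ?_, fun v w => ?_, fun v => ?_⟩
    · simp only [map_smul, LinearMap.smul_apply]
      exact U₀.smul_mem c (h1 v)
    · simp only [map_smul, LinearMap.smul_apply, smul_comm _ c, h2, smul_sub]
    · simp only [map_smul, LinearMap.smul_apply, smul_eq_mul]
      rw [← mul_add, ← h3 v, mul_zero]

/-- The elements `f` of degree `n + 2` that map `X` into `U₁` (in degree `n + 1`) and `y` into
`U₀` (in degree `n`) and satisfy `f([a, b]) = [f a, b] + [a, f b]` for `(a, b) = (v, w)` and
`(a, b) = (v, y)`, with `v, w ∈ X`. -/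
noncomputable def degNext (σ : LinearMap.BilinForm ℝ X) (n : ℕ)
    (U₀ : Submodule ℝ (ambient X (n + 1))) (U₁ : Submodule ℝ (ambient X (n + 2))) :
    Submodule ℝ (ambient X (n + 3)) where
  carrier := {f | (∀ v : X, onX (n + 2) f v ∈ U₁) ∧ onY (n + 1) f ∈ U₀ ∧
    (∀ v w : X, σ v w • onY (n + 1) f =
      onX (n + 1) (onX (n + 2) f v) w - onX (n + 1) (onX (n + 2) f w) v) ∧
    ∀ v : X, 0 = onY n (onX (n + 2) f v) - onX n (onY (n + 1) f) v}
  zero_mem' := ⟨fun v => by simp, by simp, fun v w => by simp, fun v => by simp⟩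
  add_mem' := by
    rintro f f' ⟨h1, h0, h2, h3⟩ ⟨k1, k0, k2, k3⟩
    refine ⟨fun v => ?_, ?_, fun v w => ?_, fun v => ?_⟩
    · simp only [map_add, LinearMap.add_apply]
      exact U₁.add_mem (h1 v) (k1 v)
    · rw [map_add]
      exact U₀.add_mem h0 k0
    · simp only [map_add, LinearMap.add_apply, smul_add, h2, k2]
      abel
    · simp only [map_add, LinearMap.add_apply]
      rw [add_sub_add_comm, ← h3 v, ← k3 v, add_zero]
  smul_mem' := by
    rintro c f ⟨h1, h0, h2, h3⟩
    refine ⟨fun v => ?_, ?_, fun v w => ?_, fun v => ?_⟩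
    · simp only [map_smul, LinearMap.smul_apply]
      exact U₁.smul_mem c (h1 v)
    · rw [map_smul]
      exact U₀.smul_mem c h0
    · simp only [map_smul, LinearMap.smul_apply, smul_comm _ c, h2, smul_sub]
    · simp only [map_smul, LinearMap.smul_apply]
      rw [← smul_sub, ← h3 v, smul_zero]

/-- The `k`-th Tanaka algebraic prolongation `𝔲^k(η, g)` of the pair `(η, g)`, `k ≥ 0`. -/
noncomputable def tanaka (σ : LinearMap.BilinForm ℝ X) (g : Submodule ℝ (Module.End ℝ X)) :
    (k : ℕ) → Submodule ℝ (ambient X (k + 1))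
  | 0 => degZero σ g
  | 1 => degOne σ (degZero σ g)
  | n + 2 => degNext σ n (tanaka σ g n) (tanaka σ g (n + 1))

/-- The iterated bracket `[…[[f, v], v]…, v] ∈ X` with an element `f` of degree `n - 1`. -/
noncomputable def diagonal : (n : ℕ) → ambient X n → X → X
  | 0 => fun f _ => asVector f
  | n + 1 => fun f v => diagonal n (onX n f v) v

end Tanaka

/-! Polarizing the polynomial of `f` gives the `(k+2)`-linear form `(v₀, …, v_{k+1}) ↦ σ(v_{k+1}, […
[f, v₀] …, v_k])` (`tanakaForm`). Two facts about the first prolongation `𝔲¹` carry everything; both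
are in `firstProlong_main`. First, its elements vanish on `y`. Second, its values `A = φ w` satisfy
the quadratic equation `σ(u, A u) = 0` for every `u` in a translate `e^x 𝔏_i`.

By the first fact and induction on the degree, all elements of positive degree vanish on `y`
(`tanaka_onY_eq_zero`). Hence successive brackets with vectors of `X` commute and the values of `𝔲¹`
are in the symplectic algebra, so the form is symmetric. A symmetric form is determined by its
polynomial, and `σ` is nondegenerate, which gives injectivity. By the second fact and symmetry, the
form vanishes as soon as two arguments equal the same point of `𝓔_i`. A combination of `k + 1` such
points, expanded in `k + 2` slots, repeats a point in every term, so the polynomial vanishes on `S^k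
𝓔_i`. The points of `𝓔_i` span `X`, so for large `k` the secant variety is the whole projective
space and the polynomial is zero.

The two facts come from the action of `𝔲^F` on a single row of the diagram. The block of an element
of nonnegative degree lies in a Borel subalgebra of `𝔤𝔩₂` in its irreducible representation on the
row (`entry_of_mem_uFNonneg`). The symmetry `φ v w = φ w v` for `σ v w = 0`, on sufficiently long
rows, excludes a component of `φ v` along `δ` (`firstProlong_mem_uFNonneg`). So `φ v` does not lower
degrees, and comparing degrees shows that `z = φ(y)` is orthogonal to `X_{j₀}` and that the
quadratic equations hold on `𝔏_i`. All hypotheses are invariant under `e^x`, `x ∈ δ`, so both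
conclusions spread to the translates. The translates of `X_{j₀}` span `X`, whence `z = 0`. -/

/-! ### Filtration by degree and the nonnegative part of `𝔲^F` -/

section Filtration

variable {X : Type u} [AddCommGroup X] [Module ℝ X]

/-- The decreasing filtration by degree: the sum of all components of degree at least `d / 2`. -/
def degFiltration (G : ℤ → Submodule ℝ X) (d : ℤ) : Submodule ℝ X := ⨆ j : ℤ, ⨆ _ : d ≤ j, G j

theorem positivePart_eq_degFiltration (G : ℤ → Submodule ℝ X) :
    positivePart G = degFiltration G 1 := rfl

theorem le_degFiltration (G : ℤ → Submodule ℝ X) {d j : ℤ} (h : d ≤ j) :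
    G j ≤ degFiltration G d :=
  le_iSup₂_of_le j h le_rfl

theorem degFiltration_anti (G : ℤ → Submodule ℝ X) {d e : ℤ} (h : d ≤ e) :
    degFiltration G e ≤ degFiltration G d :=
  iSup₂_le fun _ hj => le_degFiltration G (h.trans hj)

theorem degFiltration_induction {G : ℤ → Submodule ℝ X} {d : ℤ} {N : Submodule ℝ X}
    (h : ∀ j, d ≤ j → G j ≤ N) : degFiltration G d ≤ N :=
  iSup₂_le h

theorem IsGradedSymplectic.apply_eq_zero_of_degFiltration {σ : LinearMap.BilinForm ℝ X}
    {G : ℤ → Submodule ℝ X} (hX : IsGradedSymplectic σ G) {d e : ℤ} (hde : 0 < d + e) {x y : X}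
    (hx : x ∈ degFiltration G d) (hy : y ∈ degFiltration G e) : σ x y = 0 := by
  have h1 : degFiltration G d ≤ LinearMap.ker (σ.flip y) := by
    refine degFiltration_induction fun j hj x hx => ?_
    have h2 : degFiltration G e ≤ LinearMap.ker (σ x) := by
      refine degFiltration_induction fun k hk y hy => ?_
      exact hX.orthogonal j k (by omega) x hx y hy
    exact h2 hy
  exact h1 hx

/-- The part of nonnegative degree of the universal prolongation of a symbol. -/
def uFNonneg (σ : LinearMap.BilinForm ℝ X) (G : ℤ → Submodule ℝ X)
    (δ : Submodule ℝ (Module.End ℝ X)) : Submodule ℝ (Module.End ℝ X) :=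
  ⨆ n : ℕ, flagProlong σ G δ (n + 2)

theorem flagProlong_le_endGr {σ : LinearMap.BilinForm ℝ X} {G : ℤ → Submodule ℝ X}
    {δ : Submodule ℝ (Module.End ℝ X)} (n : ℕ) {A : Module.End ℝ X}
    (hA : A ∈ flagProlong σ G δ (n + 2)) : A ∈ endGr G n :=
  hA.1.2

theorem uFNonneg_apply_mem {σ : LinearMap.BilinForm ℝ X} {G : ℤ → Submodule ℝ X}
    {δ : Submodule ℝ (Module.End ℝ X)} {A : Module.End ℝ X} (hA : A ∈ uFNonneg σ G δ) {d : ℤ}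
    {x : X} (hx : x ∈ degFiltration G d) : A x ∈ degFiltration G d := by
  have h1 : uFNonneg σ G δ ≤ (degFiltration G d).comap (LinearMap.applyₗ x) := by
    refine iSup_le fun n A hA => ?_
    have h2 : degFiltration G d ≤ (degFiltration G d).comap A := by
      refine degFiltration_induction fun j hj x hx => ?_
      exact le_degFiltration G (by omega) (flagProlong_le_endGr n hA j x hx)
    exact h2 hx
  exact h1 hA

end Filtration

/-! ### Numerical consequences of the conditions on the diagram -/

namespace JacobiDiagram

variable {D : JacobiDiagram}

/-- Condition (1) for the two rows of one component says that the lower row starts strictly to the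
left of the end of the upper row, that is, `s < l`. In particular both rows cross the column of
degree `0`. -/
theorem Cond1.S_lt (h1 : D.Cond1) (i : Fin D.r) : D.S i < 2 * D.l i := by
  have h := h1 (.inl (.inl i)) (.inl (.inr i)) (by simp)
  simp only [top, bot, len] at h
  push_cast at h
  omega

theorem Cond1.even_S (h1 : D.Cond1) (i : Fin D.r) : Even (D.S i) := by
  by_contra h
  have h2 := D.half i (Nat.not_even_iff_odd.1 h)
  have h3 := h1.S_lt i
  omega

theorem Cond3.three_le (h1 : D.Cond1) (h3 : D.Cond3) (i : Fin D.r) : 3 ≤ D.l i := by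
  have h := h3 (.inl (.inl i)) (by simpa [top] using h1.even_S i)
  simp only [len] at h
  omega

theorem Cond4.five_le (h4 : D.Cond4) (i : Fin D.t) : 5 ≤ D.M i := by
  have h := h4 (.inr i) (by simpa [top] using D.M_odd i)
  simp only [len] at h
  omega

/-- The first box of every row lies in `X_{j₀}`, which is why `δ` generates `X` from `X_{j₀}`. -/
theorem top_pos (h1 : D.Cond1) (a : D.Row) : 0 < D.top a := by
  rcases a with (i | i) | i
  · have := h1.S_lt i
    have := D.l_le i
    simp only [top]
    omega
  · have := h1.S_lt i
    simp only [top]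
    omega
  · have := (D.M_odd i).pos
    simp only [top]
    omega

theorem len_pos (D : JacobiDiagram) (a : D.Row) : 0 < D.len a := by
  rcases a with (i | i) | i <;> simp [len]

theorem three_lt_len (h1 : D.Cond1) (h3 : D.Cond3) (h4 : D.Cond4) (a : D.Row) : 3 < D.len a := by
  rcases a with (i | i) | i
  · have := h3.three_le h1 i
    simp only [len]
    omega
  · have := h3.three_le h1 i
    simp only [len]
    omega
  · have := h4.five_le i
    simp only [len]
    omega

theorem pairing_same_row (a : D.Row) (j k : Fin (D.len a)) (h : D.pairing ⟨a, j⟩ ⟨a, k⟩ ≠ 0) :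
    ∃ i : Fin D.t, a = .inr i ∧ (j : ℕ) + k = D.M i := by
  rcases a with (i | i) | i
  · simp [pairing] at h
  · simp [pairing] at h
  · refine ⟨i, rfl, ?_⟩
    by_contra h'
    simp [pairing, h'] at h

end JacobiDiagram

/-! ### Coordinates along the rows and the shift operator -/

section Rows

variable {X : Type u} [AddCommGroup X] [Module ℝ X] {σ : LinearMap.BilinForm ℝ X}
  {G : ℤ → Submodule ℝ X} {δ : Submodule ℝ (Module.End ℝ X)} {D : JacobiDiagram}

namespace SkewTableau

/-- The part of `x` supported on boxes of other degrees is in `G d`, being a difference of elements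
of `G d`, and also in the sum of the other components; independence of the grading makes it zero. -/
theorem repr_eq_zero (hX : IsGradedSymplectic σ G) (T : SkewTableau D σ G δ) {d : ℤ} {x : X}
    (hx : x ∈ G d) {b : D.Box} (hb : D.deg b ≠ d) : T.basis.repr x b = 0 := by
  classical
  have hsum : x = ∑ b ∈ Finset.univ.filter (fun b => D.deg b = d), T.basis.repr x b • T.basis b +
      ∑ b ∈ Finset.univ.filter (fun b => ¬ D.deg b = d), T.basis.repr x b • T.basis b := by
    rw [Finset.sum_filter_add_sum_filter_not, T.basis.sum_repr]
  set y := ∑ b ∈ Finset.univ.filter (fun b => D.deg b = d), T.basis.repr x b • T.basis b with hy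
  set z := ∑ b ∈ Finset.univ.filter (fun b => ¬ D.deg b = d), T.basis.repr x b • T.basis b with hz
  have hyG : y ∈ G d := by
    refine Submodule.sum_mem _ fun b hb => Submodule.smul_mem _ _ ?_
    have := T.basis_mem b
    rwa [(Finset.mem_filter.1 hb).2] at this
  have hzG : z ∈ ⨆ (j : ℤ) (_ : j ≠ d), G j := by
    refine Submodule.sum_mem _ fun b hb => Submodule.smul_mem _ _ ?_
    exact (le_iSup₂_of_le (f := fun (j : ℤ) (_ : j ≠ d) => G j) (D.deg b)
      (Finset.mem_filter.1 hb).2 le_rfl) (T.basis_mem b)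
  have hzG' : z ∈ G d := by
    have : z = x - y := by rw [hsum]; abel
    rw [this]
    exact (G d).sub_mem hx hyG
  have hz0 : z = 0 :=
    Submodule.disjoint_def.1 (hX.internal.submodule_iSupIndep d) z hzG' hzG
  have hrep : T.basis.repr z b = T.basis.repr x b := by
    rw [hz, map_sum, Finsupp.finsetSum_apply, Finset.sum_eq_single b]
    · simp
    · intro c _ hc
      simp [hc]
    · intro hb'
      exact absurd (Finset.mem_filter.2 ⟨Finset.mem_univ b, hb⟩) hb'
  rw [← hrep, hz0]
  simp

theorem repr_eq_zero_of_degFiltration (hX : IsGradedSymplectic σ G) (T : SkewTableau D σ G δ)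
    {d : ℤ} {x : X} (hx : x ∈ degFiltration G d) {b : D.Box} (hb : D.deg b < d) :
    T.basis.repr x b = 0 := by
  have h : degFiltration G d ≤ LinearMap.ker (T.basis.coord b) :=
    degFiltration_induction fun j hj x hx => T.repr_eq_zero hX hx (by omega)
  exact h hx

variable (T : SkewTableau D σ G δ)

/-- The entry number `j` of the row `a`, extended by `0` beyond the end of the row. -/
noncomputable def row (a : D.Row) (j : ℕ) : X :=
  if h : j < D.len a then T.basis ⟨a, ⟨j, h⟩⟩ else 0

/-- The coordinate at the entry number `j` of the row `a`. -/
noncomputable def coef (a : D.Row) (j : ℕ) : X →ₗ[ℝ] ℝ :=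
  if h : j < D.len a then T.basis.coord ⟨a, ⟨j, h⟩⟩ else 0

theorem row_of_lt {a : D.Row} {j : ℕ} (h : j < D.len a) : T.row a j = T.basis ⟨a, ⟨j, h⟩⟩ :=
  dif_pos h

theorem row_of_le {a : D.Row} {j : ℕ} (h : D.len a ≤ j) : T.row a j = 0 :=
  dif_neg (by omega)

theorem coef_of_lt {a : D.Row} {j : ℕ} (h : j < D.len a) (x : X) :
    T.coef a j x = T.basis.repr x ⟨a, ⟨j, h⟩⟩ := by
  rw [coef, dif_pos h, Module.Basis.coord_apply]

theorem basis_eq_row (b : D.Box) : T.basis b = T.row b.1 b.2 := by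
  rw [T.row_of_lt b.2.2]

theorem gen_row (a : D.Row) (j : ℕ) : T.gen (T.row a j) = T.row a (j + 1) := by
  by_cases h : j < D.len a
  · rw [T.row_of_lt h, T.gen_basis]
    by_cases h' : j + 1 < D.len a
    · rw [T.row_of_lt h']
      simp [h']
    · rw [T.row_of_le (by omega)]
      simp [h']
  · rw [T.row_of_le (by omega), T.row_of_le (by omega), map_zero]

theorem gen_pow_row (a : D.Row) (j k : ℕ) : (T.gen ^ k) (T.row a j) = T.row a (j + k) := by
  induction k with
  | zero => simp
  | succ k ih => rw [pow_succ', Module.End.mul_apply, ih, T.gen_row, add_assoc]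

theorem coef_row {a : D.Row} {i : ℕ} (hi : i < D.len a) (j : ℕ) :
    T.coef a i (T.row a j) = if i = j then 1 else 0 := by
  by_cases hj : j < D.len a
  · rw [T.coef_of_lt hi, T.row_of_lt hj, Module.Basis.repr_self, Finsupp.single_apply]
    simp [eq_comm]
  · rw [T.row_of_le (by omega), map_zero, if_neg (by omega)]

theorem linearMap_ext_row {V : Type*} [AddCommGroup V] [Module ℝ V] {f g : X →ₗ[ℝ] V}
    (h : ∀ a j, f (T.row a j) = g (T.row a j)) : f = g :=
  T.basis.ext fun b => by rw [T.basis_eq_row]; exact h _ _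

theorem coef_succ_gen {a : D.Row} {i : ℕ} (hi : i + 1 < D.len a) (x : X) :
    T.coef a (i + 1) (T.gen x) = T.coef a i x := by
  have : T.coef a (i + 1) ∘ₗ T.gen = T.coef a i := by
    refine T.basis.ext fun b => ?_
    obtain ⟨c, j⟩ := b
    rw [LinearMap.comp_apply, T.basis_eq_row, T.gen_row]
    simp only
    by_cases hc : c = a
    · subst hc
      rw [T.coef_row hi, T.coef_row (by omega)]
      simp
    · have h0 : ∀ k (hk : k < D.len a) l, T.coef a k (T.row c l) = 0 := by
        intro k hk l
        by_cases hl : l < D.len c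
        · rw [T.coef_of_lt hk, T.row_of_lt hl, Module.Basis.repr_self, Finsupp.single_apply,
            if_neg]
          intro h
          exact hc (congrArg Sigma.fst h)
        · rw [T.row_of_le (by omega), map_zero]
      rw [h0 _ hi, h0 _ (by omega)]
  exact LinearMap.congr_fun this x

theorem coef_zero_gen (a : D.Row) (ha : 0 < D.len a) (x : X) : T.coef a 0 (T.gen x) = 0 := by
  have : T.coef a 0 ∘ₗ T.gen = 0 := by
    refine T.basis.ext fun b => ?_
    obtain ⟨c, j⟩ := b
    rw [LinearMap.comp_apply, T.basis_eq_row, T.gen_row, LinearMap.zero_apply]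
    simp only
    by_cases hl : (j : ℕ) + 1 < D.len c
    · rw [T.coef_of_lt ha, T.row_of_lt hl, Module.Basis.repr_self, Finsupp.single_apply, if_neg]
      rintro h
      obtain rfl := congrArg Sigma.fst h
      simp at h
    · rw [T.row_of_le (by omega), map_zero]
  exact LinearMap.congr_fun this x

theorem row_mem (a : D.Row) (j : ℕ) : T.row a j ∈ G (D.top a - 2 * j) := by
  by_cases h : j < D.len a
  · rw [T.row_of_lt h]
    exact T.basis_mem ⟨a, ⟨j, h⟩⟩
  · rw [T.row_of_le (by omega)]
    exact Submodule.zero_mem _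

theorem coef_eq_zero (hX : IsGradedSymplectic σ G) {d : ℤ} {x : X} (hx : x ∈ G d) (a : D.Row)
    {j : ℕ} (h : D.top a - 2 * j ≠ d) : T.coef a j x = 0 := by
  by_cases hj : j < D.len a
  · rw [T.coef_of_lt hj]
    exact T.repr_eq_zero hX hx h
  · rw [coef, dif_neg hj, LinearMap.zero_apply]

theorem σ_row_same {a : D.Row} {j k : ℕ} (h : σ (T.row a j) (T.row a k) ≠ 0) :
    ∃ i : Fin D.t, a = .inr i ∧ j + k = D.M i := by
  by_cases hj : j < D.len a
  · by_cases hk : k < D.len a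
    · rw [T.row_of_lt hj, T.row_of_lt hk, T.pairing_eq] at h
      exact JacobiDiagram.pairing_same_row a ⟨j, hj⟩ ⟨k, hk⟩ (by exact_mod_cast h)
    · rw [T.row_of_le (Nat.le_of_not_lt hk), map_zero] at h
      exact absurd rfl h
  · rw [T.row_of_le (Nat.le_of_not_lt hj), map_zero, LinearMap.zero_apply] at h
    exact absurd rfl h

theorem gen_mem : T.gen ∈ δ := by
  have h : Submodule.span ℝ {T.gen} ≤ δ := T.gen_span.ge
  exact h (Submodule.mem_span_singleton_self T.gen)

theorem exists_smul_gen {x : Module.End ℝ X} (hx : x ∈ δ) : ∃ t : ℝ, x = t • T.gen := by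
  rw [T.gen_span] at hx
  obtain ⟨t, rfl⟩ := Submodule.mem_span_singleton.1 hx
  exact ⟨t, rfl⟩

/-- A generator of the symbol belongs to the symplectic algebra. -/
theorem σ_gen (x y : X) : σ (T.gen x) y = -σ x (T.gen y) := by
  have h : σ ∘ₗ T.gen = -(σ.compl₂ T.gen) := by
    refine T.basis.ext fun b => T.basis.ext fun c => ?_
    obtain ⟨b, j⟩ := b
    obtain ⟨c, k⟩ := c
    simp only [LinearMap.comp_apply, LinearMap.neg_apply, LinearMap.compl₂_apply, T.gen_basis]
    have hj := j.2
    have hk := k.2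
    -- For boxes number `j` and `k` both sides can be nonzero only if `j + k + 1` is `l_i` (or
    -- `M_i`), which is impossible when one of the shifts leaves its row; otherwise the alternating
    -- sign `(-1)^j` yields the minus.
    split_ifs with hb hc hc <;>
    rcases b with (b | b) | b <;> rcases c with (c | c) | c <;>
    simp only [T.pairing_eq, JacobiDiagram.pairing, map_zero, LinearMap.zero_apply, neg_zero,
      Int.cast_zero] <;>
    simp only [JacobiDiagram.len] at hj hk hb hc <;>
    by_cases hbc : b = c <;>
    simp only [hbc, eq_comm (a := c) (b := b), false_and, if_false, neg_zero, Int.cast_zero] <;>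
    subst hbc <;>
    simp only [true_and] <;>
    split_ifs <;>
    first
    | omega
    | (push_cast; ring)
  have := LinearMap.congr_fun (LinearMap.congr_fun h x) y
  simpa using this

end SkewTableau

end Rows

/-! ### Blocks of `𝔲^F` on one row; absence of a `δ`-component in the first prolongation -/

section Blocks

variable {X : Type u} [AddCommGroup X] [Module ℝ X] {σ : LinearMap.BilinForm ℝ X}
  {G : ℤ → Submodule ℝ X} {δ : Submodule ℝ (Module.End ℝ X)} {D : JacobiDiagram}

namespace SkewTableau

theorem bracket_gen_mem (T : SkewTableau D σ G δ) {n : ℕ} {A : Module.End ℝ X}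
    (hA : A ∈ flagProlong σ G δ (n + 2)) : A * T.gen - T.gen * A ∈ flagProlong σ G δ n :=
  hA.2 _ T.gen_mem

/-- The matrix entries of the block of an endomorphism that maps a row to itself. -/
noncomputable def entry (T : SkewTableau D σ G δ) (a : D.Row) (A : Module.End ℝ X) (i j : ℕ) : ℝ :=
  T.coef a i (A (T.row a j))

variable (T : SkewTableau D σ G δ)

theorem entry_gen {a : D.Row} {i : ℕ} (hi : i < D.len a) (j : ℕ) :
    T.entry a T.gen i j = if i = j + 1 then 1 else 0 := by
  rw [entry, T.gen_row, T.coef_row hi]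

theorem entry_bracket_gen_succ {a : D.Row} {i : ℕ} (hi : i + 1 < D.len a) (A : Module.End ℝ X)
    (j : ℕ) : T.entry a (A * T.gen - T.gen * A) (i + 1) j =
      T.entry a A (i + 1) (j + 1) - T.entry a A i j := by
  simp only [entry, LinearMap.sub_apply, Module.End.mul_apply, map_sub, T.gen_row,
    T.coef_succ_gen hi]

theorem entry_bracket_gen_zero {a : D.Row} (ha : 0 < D.len a) (A : Module.End ℝ X)
    (j : ℕ) : T.entry a (A * T.gen - T.gen * A) 0 j = T.entry a A 0 (j + 1) := by
  simp only [entry, LinearMap.sub_apply, Module.End.mul_apply, map_sub, T.gen_row,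
    T.coef_zero_gen a ha, sub_zero]

theorem entry_of_le {a : D.Row} {j : ℕ} (h : D.len a ≤ j) (A : Module.End ℝ X) (i : ℕ) :
    T.entry a A i j = 0 := by
  rw [entry, T.row_of_le h, map_zero, map_zero]

/-- Degrees within a row differ by integers. So an element of degree `n / 2` has a block supported
on a single diagonal, and a zero block if `n` is odd. -/
theorem entry_eq_zero (hX : IsGradedSymplectic σ G) {n : ℕ} {A : Module.End ℝ X}
    (hA : A ∈ flagProlong σ G δ (n + 2)) (a : D.Row) {i j : ℕ} (h : i + i + n ≠ j + j) :
    T.entry a A i j = 0 :=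
  T.coef_eq_zero hX (flagProlong_le_endGr n hA _ _ (T.row_mem a j)) a (by omega)

/-- In degree `0` the bracket with the shift is a multiple `c` of the shift, so consecutive diagonal
entries differ by `c`. -/
theorem entry_diag {A : Module.End ℝ X} (hA : A ∈ flagProlong σ G δ 2) (a : D.Row) :
    ∃ p c : ℝ, ∀ i < D.len a, T.entry a A i i = p + c * i := by
  have hB := T.bracket_gen_mem (n := 0) hA
  obtain ⟨c, hc⟩ := T.exists_smul_gen hB
  refine ⟨T.entry a A 0 0, c, fun i => ?_⟩
  induction i with
  | zero => simp
  | succ i ih =>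
    intro hi
    have h := T.entry_bracket_gen_succ hi A i
    rw [hc] at h
    have h2 : T.entry a (c • T.gen) (i + 1) i = c := by
      have := T.entry_gen hi i
      rw [if_pos rfl] at this
      rw [entry, LinearMap.smul_apply, map_smul, smul_eq_mul, ← entry, this, mul_one]
    rw [h2, ih (by omega)] at h
    push_cast
    linarith

/-- In degree `1` the entries are partial sums of an arithmetic progression. They must sum to zero
at the end of the row, which leaves one parameter: the multiples of the raising operator of `𝔰𝔩₂`.
-/
theorem entry_raise {A : Module.End ℝ X} (hA : A ∈ flagProlong σ G δ 4) (a : D.Row) :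
    ∃ r : ℝ, ∀ i < D.len a, T.entry a A i (i + 1) = r * ((i + 1) * (D.len a - 1 - i)) := by
  obtain ⟨p, c, h⟩ := T.entry_diag (T.bracket_gen_mem (n := 2) hA) a
  have h1 : ∀ i < D.len a, T.entry a A i (i + 1) = p * (i + 1) + c * (i * (i + 1) / 2) := by
    intro i
    induction i with
    | zero =>
      intro hi
      have h2 := h 0 hi
      rw [T.entry_bracket_gen_zero hi] at h2
      simp [h2]
    | succ i ih =>
      intro hi
      have h2 := h _ hi
      rw [T.entry_bracket_gen_succ hi, ih (by omega)] at h2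
      push_cast at h2 ⊢
      linarith
  have hpos := D.len_pos a
  -- In the last line of the block the superdiagonal entry lies past the end of the row, hence is
  -- `0`; this determines `p` in terms of `c`.
  have h2 := h1 (D.len a - 1) (by omega)
  rw [T.entry_of_le (by omega)] at h2
  have h3 : ((D.len a - 1 : ℕ) : ℝ) = D.len a - 1 := by
    rw [Nat.cast_sub hpos, Nat.cast_one]
  rw [h3] at h2
  have h4 : (0 : ℝ) < D.len a := by exact_mod_cast hpos
  have h5 : p = -(c * (D.len a - 1) / 2) := by
    have : (D.len a : ℝ) * (p + c * (D.len a - 1) / 2) = 0 := by linear_combination -h2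
    have := (mul_eq_zero.1 this).resolve_left h4.ne'
    linarith
  refine ⟨-(c / 2), fun i hi => ?_⟩
  rw [h1 i hi, h5]
  ring

/-- Summing the entries of degree `1` gives a cubic with a single parameter `r`. The condition at
the end of the row, read at index `len - 2`, is `r (len - 1) len (len + 1) = 0`, so nothing survives
in degree `2`. -/
theorem entry_raise_two {A : Module.End ℝ X} (hA : A ∈ flagProlong σ G δ 6) (a : D.Row)
    {i : ℕ} (hi : i < D.len a) : T.entry a A i (i + 2) = 0 := by
  obtain ⟨r, h⟩ := T.entry_raise (T.bracket_gen_mem (n := 4) hA) a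
  have h1 : ∀ i < D.len a, T.entry a A i (i + 2) =
      r * ((i + 1) * (i + 2) * (3 * D.len a - 3 - 2 * i) / 6) := by
    intro i
    induction i with
    | zero =>
      intro hi
      have h2 := h 0 hi
      rw [T.entry_bracket_gen_zero hi] at h2
      rw [h2]
      push_cast
      ring
    | succ i ih =>
      intro hi
      have h2 := h _ hi
      rw [T.entry_bracket_gen_succ hi, ih (by omega)] at h2
      push_cast at h2 ⊢
      linear_combination h2
  by_cases hl : D.len a = 1
  · exact T.entry_of_le (by omega) _ _
  have hpos := D.len_pos a
  have h2 := h1 (D.len a - 2) (by omega)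
  rw [T.entry_of_le (by omega)] at h2
  have h3 : ((D.len a - 2 : ℕ) : ℝ) = D.len a - 2 := by
    rw [Nat.cast_sub (by omega)]
    norm_num
  rw [h3] at h2
  have h4 : (2 : ℝ) ≤ D.len a := by exact_mod_cast (by omega : 2 ≤ D.len a)
  have h5 : r = 0 := by
    have h6 : r * (((D.len a : ℝ) - 1) * D.len a * (D.len a + 1)) = 0 := by
      linear_combination -6 * h2
    refine (mul_eq_zero.1 h6).resolve_right (ne_of_gt ?_)
    have : (0 : ℝ) < D.len a - 1 := by linarith
    positivity
  rw [h1 i hi, h5, zero_mul]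

/-- The index `2 * k + 6` is the degree `k + 2`. The bracket with the shift has zero block by
induction on `k`, so the entries are constant along the diagonal, and the first of them is itself an
entry of the bracket. -/
theorem entry_raise_of_two_le (k : ℕ) {A : Module.End ℝ X}
    (hA : A ∈ flagProlong σ G δ (2 * k + 6)) (a : D.Row) {i : ℕ} (hi : i < D.len a) :
    T.entry a A i (i + k + 2) = 0 := by
  induction k generalizing A i with
  | zero => exact T.entry_raise_two hA a hi
  | succ k ih =>
    have hB := T.bracket_gen_mem (n := 2 * k + 6) hA
    induction i with
    | zero =>
      have h := ih hB hi
      rw [T.entry_bracket_gen_zero hi] at h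
      exact h
    | succ i ih' =>
      have h := ih hB hi
      rw [show i + 1 + k + 2 = i + (k + 1) + 2 by ring, T.entry_bracket_gen_succ hi,
        ih' (by omega), sub_zero] at h
      rw [← h]
      congr 1
      ring

/-- The blocks on a row of the elements of nonnegative degree of the universal prolongation
belong to the representation of a Borel subalgebra of `𝔤𝔩₂`. -/
theorem entry_of_mem_uFNonneg (hX : IsGradedSymplectic σ G) {A : Module.End ℝ X}
    (hA : A ∈ uFNonneg σ G δ) (a : D.Row) :
    ∃ p c r : ℝ, ∀ i < D.len a, ∀ j, j < D.len a → T.entry a A i j =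
      if j = i then p + c * i else if j = i + 1 then r * ((i + 1) * (D.len a - 1 - i)) else 0 := by
  refine Submodule.iSup_induction _ (motive := fun A => ∃ p c r : ℝ, ∀ i < D.len a, ∀ j,
    j < D.len a → T.entry a A i j = if j = i then p + c * i
      else if j = i + 1 then r * ((i + 1) * (D.len a - 1 - i)) else 0) hA ?_ ?_ ?_
  · intro n A hA
    by_cases h0 : n = 0
    · subst h0
      obtain ⟨p, c, h⟩ := T.entry_diag hA a
      refine ⟨p, c, 0, fun i hi j _ => ?_⟩
      split_ifs with h1 h2
      · subst h1
        exact h j hi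
      · rw [zero_mul, T.entry_eq_zero hX hA a (by omega)]
      · exact T.entry_eq_zero hX hA a (by omega)
    by_cases h2 : n = 2
    · subst h2
      obtain ⟨r, h⟩ := T.entry_raise hA a
      refine ⟨0, 0, r, fun i hi j _ => ?_⟩
      split_ifs with h1 h2
      · rw [T.entry_eq_zero hX hA a (by omega)]
        ring
      · subst h2
        exact h i hi
      · exact T.entry_eq_zero hX hA a (by omega)
    · refine ⟨0, 0, 0, fun i hi j _ => ?_⟩
      have h : T.entry a A i j = 0 := by
        by_cases hn : i + i + n = j + j
        · obtain ⟨k, rfl⟩ : ∃ k, n = 2 * k + 4 := ⟨j - i - 2, by omega⟩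
          obtain rfl : j = i + k + 2 := by omega
          exact T.entry_raise_of_two_le k hA a hi
        · exact T.entry_eq_zero hX hA a hn
      rw [h]
      simp
  · exact ⟨0, 0, 0, fun i _ j _ => by simp [entry]⟩
  · rintro A B ⟨p, c, r, h⟩ ⟨p', c', r', h'⟩
    refine ⟨p + p', c + c', r + r', fun i hi j hj => ?_⟩
    rw [entry, LinearMap.add_apply, map_add, ← entry, ← entry, h i hi j hj, h' i hi j hj]
    split_ifs <;> ring

theorem exists_sub_smul_gen_mem {A : Module.End ℝ X} (hA : A ∈ uF σ G δ) :
    ∃ α : ℝ, A - α • T.gen ∈ uFNonneg σ G δ := by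
  refine Submodule.iSup_induction _
    (motive := fun A => ∃ α : ℝ, A - α • T.gen ∈ uFNonneg σ G δ) hA ?_ ?_ ?_
  · rintro (_ | _ | n) A hA
    · obtain ⟨t, rfl⟩ := T.exists_smul_gen hA
      exact ⟨t, by simp⟩
    · have : A = 0 := hA
      exact ⟨0, by simp [this]⟩
    · refine ⟨0, ?_⟩
      rw [zero_smul, sub_zero]
      exact le_iSup (fun n => flagProlong σ G δ (n + 2)) n hA
  · exact ⟨0, by simp⟩
  · rintro A B ⟨α, hα⟩ ⟨β, hβ⟩
    refine ⟨α + β, ?_⟩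
    rw [add_smul, add_sub_add_comm]
    exact add_mem hα hβ

end SkewTableau

/-- The elements of the first prolongation over the Heisenberg algebra of a subspace `g` of the
conformal symplectic algebra, described by the restriction `φ` to `X` and the value `z` at `y`. -/
structure IsFirstProlong (σ : LinearMap.BilinForm ℝ X) (g : Submodule ℝ (Module.End ℝ X))
    (φ : X →ₗ[ℝ] Module.End ℝ X) (z : X) : Prop where
  mem : ∀ v, φ v ∈ g
  comm : ∀ v w, φ v w - φ w v = σ v w • z
  conformal : ∀ u v w, σ (φ u v) w + σ v (φ u w) = -σ u z * σ v w

namespace SkewTableau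

/-- Under the conditions on the diagram, the elements of the first prolongation take no values
with a component of degree `-1`. -/
theorem firstProlong_mem_uFNonneg (T : SkewTableau D σ G δ) (hX : IsGradedSymplectic σ G) (h1 : D.Cond1) (h3 : D.Cond3)
    (h4 : D.Cond4) {φ : X →ₗ[ℝ] Module.End ℝ X} {z : X}
    (hφ : IsFirstProlong σ (uF σ G δ) φ z) (v : X) : φ v ∈ uFNonneg σ G δ := by
  suffices h : ∀ b, φ (T.basis b) ∈ uFNonneg σ G δ by
    rw [← T.basis.sum_repr v, map_sum]
    exact Submodule.sum_mem _ fun b _ => by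
      rw [map_smul]
      exact Submodule.smul_mem _ _ (h b)
  rintro ⟨a, q, hq⟩
  rw [← T.row_of_lt hq]
  obtain ⟨n, hn⟩ : ∃ n, D.len a = n + 1 := ⟨D.len a - 1, by have := D.len_pos a; omega⟩
  have hn3 : 3 < D.len a := JacobiDiagram.three_lt_len h1 h3 h4 a
  choose α hα using fun j => T.exists_sub_smul_gen_mem (hφ.mem (T.row a j))
  choose p c r hE using fun j => T.entry_of_mem_uFNonneg hX (hα j) a
  have hentry : ∀ k i j, i < D.len a → j < D.len a → T.entry a (φ (T.row a k)) i j =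
      (if i = j + 1 then α k else 0) + if j = i then p k + c k * i else
        if j = i + 1 then r k * ((i + 1) * (D.len a - 1 - i)) else 0 := by
    intro k i j hi hj
    rw [← hE k i hi j hj]
    have h := T.entry_gen hi j
    simp only [entry, LinearMap.sub_apply, LinearMap.smul_apply, map_sub, map_smul,
      smul_eq_mul] at h ⊢
    rw [h]
    split_ifs <;> ring
  -- The only relation used below: `φ v w = φ w v` for orthogonal `v`, `w`, read in one coordinate
  -- of the row.
  have hcomm : ∀ k l i, σ (T.row a k) (T.row a l) = 0 →
      T.entry a (φ (T.row a k)) i l = T.entry a (φ (T.row a l)) i k := by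
    intro k l i h
    have h' := hφ.comm (T.row a k) (T.row a l)
    rw [h, zero_smul, sub_eq_zero] at h'
    rw [entry, entry, h']
  have hpair : ∀ k l, σ (T.row a k) (T.row a l) ≠ 0 → k + l = n ∧ 5 ≤ n ∧ Odd n := by
    intro k l h
    obtain ⟨i, rfl, hi⟩ := T.σ_row_same h
    have h5 := h4.five_le i
    have hodd := D.M_odd i
    simp only [JacobiDiagram.len] at hn
    obtain rfl : D.M i = n := by omega
    exact ⟨hi, h5, hodd⟩
  have hpair' : ∀ k l, ¬ (k + l = n ∧ 5 ≤ n ∧ Odd n) → σ (T.row a k) (T.row a l) = 0 :=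
    fun k l h => not_not.1 fun h' => h (hpair k l h')
  -- `α q` is the subdiagonal entry `(k + 1, k)` of `φ (row q)`, hence the entry `(k + 1, q)` of `φ
  -- (row k)`, which is off the three diagonals unless `q` is `k`, `k + 1` or `k + 2`. It remains to
  -- find a suitable `k` orthogonal to `q`.
  have main : ∀ k, k + 1 < D.len a → q ≠ k → q ≠ k + 1 → q ≠ k + 2 →
      σ (T.row a k) (T.row a q) = 0 → α q = 0 := by
    intro k hk h0 h1 h2 hσ
    have h := hcomm k q (k + 1) hσ
    rw [hentry k _ _ hk hq, hentry q _ _ hk (by omega)] at h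
    have h3 : ¬ k = k + 1 + 1 := by omega
    simpa [h0, h1, h2, h0.symm, h3] using h.symm
  have hαq : α q = 0 := by
    rcases Nat.lt_or_ge (q + 1) n with hq1 | hq1
    -- The choice `k = n - 1` may fail for `q = 1`, since in the row of `τ_m` these boxes are
    -- paired; then `k = n - 2` works.
    · by_cases hqn : q = 1 ∧ 5 ≤ n
      · refine main (n - 2) (by omega) (by omega) (by omega) (by omega) (hpair' _ _ ?_)
        omega
      · refine main (n - 1) (by omega) (by omega) (by omega) (by omega) (hpair' _ _ ?_)
        omega
    · rcases Nat.lt_or_ge q n with hq2 | hq2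
      -- For the last box but one a row of four boxes has no suitable `k`. Comparing rows `m` and `m
      -- + 3` first gives `r m = 0`; comparing `m` and `m + 2` then expresses `α q` as a multiple of
      -- `r m`.
      · obtain ⟨m, rfl⟩ : ∃ m, n = m + 3 := ⟨n - 3, by omega⟩
        obtain rfl : q = m + 2 := by omega
        have e1 : σ (T.row a m) (T.row a (m + 2)) = 0 := hpair' _ _ (by
          rintro ⟨_, _, k, hk⟩
          omega)
        have e2 : σ (T.row a m) (T.row a (m + 3)) = 0 := hpair' _ _ (by omega)
        have f1 := hcomm m (m + 2) (m + 1) e1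
        have f2 := hcomm m (m + 3) (m + 2) e2
        rw [hentry _ _ _ (by omega) (by omega), hentry _ _ _ (by omega) (by omega), hn] at f1 f2
        simp at f1 f2
        have hm : (m : ℝ) + 2 + 1 ≠ 0 := by positivity
        rw [if_neg (by omega)] at f1 f2
        have hr : r m = 0 := by
          refine (mul_eq_zero.1 f2).resolve_right ?_
          norm_num
          exact hm
        rw [hr] at f1
        linarith
      · refine main (n - 3) (by omega) (by omega) (by omega) (by omega) (hpair' _ _ ?_)
        omega
  have := hα q
  rwa [hαq, zero_smul, sub_zero] at this

end SkewTableau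

end Blocks

/-! ### Orthogonality of `z` to `X_{j₀}` and quadratic equations on `𝔏_i` -/

section Quadrics

variable {X : Type u} [AddCommGroup X] [Module ℝ X] {σ : LinearMap.BilinForm ℝ X}
  {G : ℤ → Submodule ℝ X} {δ : Submodule ℝ (Module.End ℝ X)} {D : JacobiDiagram}

namespace SkewTableau

/-- `φ u v = φ v u` has positive degree for `v` of degree `0`, so `φ u` contributes nothing to
pairings in degree `0`, and its conformal factor `-σ u z` must vanish. -/
theorem apply_eq_zero_of_pos_integer_row (hX : IsGradedSymplectic σ G)
    {φ : X →ₗ[ℝ] Module.End ℝ X} {z : X} (hφ : IsFirstProlong σ (uFNonneg σ G δ) φ z)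
    {v w : X} (hv : v ∈ G 0) (hw : w ∈ G 0) (hvw : σ v w ≠ 0) {u : X} (hu : u ∈ positivePart G) :
    σ u z = 0 := by
  rw [positivePart_eq_degFiltration] at hu
  have key : ∀ v ∈ G 0, φ u v ∈ degFiltration G 1 := by
    intro v hv
    have h := hφ.comm u v
    rw [hX.apply_eq_zero_of_degFiltration (by norm_num) hu (le_degFiltration G le_rfl hv),
      zero_smul, sub_eq_zero] at h
    rw [h]
    exact uFNonneg_apply_mem (hφ.mem v) hu
  have h := hφ.conformal u v w
  rw [hX.apply_eq_zero_of_degFiltration (by norm_num) (key v hv) (le_degFiltration G le_rfl hw),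
    hX.apply_eq_zero_of_degFiltration (by norm_num) (le_degFiltration G le_rfl hv) (key w hw),
    add_zero] at h
  have := (mul_eq_zero.1 h.symm).resolve_right hvw
  linarith

theorem mem_of_forall_row (T : SkewTableau D σ G δ) {N : Submodule ℝ X}
    (h : ∀ a j, j < D.len a → T.row a j ∈ N) (x : X) : x ∈ N := by
  rw [← T.basis.sum_repr x]
  refine Submodule.sum_mem _ fun b _ => Submodule.smul_mem _ _ ?_
  rw [T.basis_eq_row]
  exact h _ _ b.2.2

theorem positivePart_le (hX : IsGradedSymplectic σ G) (T : SkewTableau D σ G δ)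
    {N : Submodule ℝ X} (h : ∀ a j, j < D.len a → 2 * (j : ℤ) < D.top a → T.row a j ∈ N) :
    positivePart G ≤ N := by
  intro x hx
  rw [← T.basis.sum_repr x]
  refine Submodule.sum_mem _ fun b _ => ?_
  by_cases hb : D.deg b < 1
  · rw [T.repr_eq_zero_of_degFiltration hX hx hb, zero_smul]
    exact Submodule.zero_mem _
  · refine Submodule.smul_mem _ _ ?_
    rw [T.basis_eq_row]
    refine h _ _ b.2.2 ?_
    simp only [JacobiDiagram.deg] at hb
    omega

theorem σ_row_half (T : SkewTableau D σ G δ) (i : Fin D.t) {j k : ℕ} (hjk : j + k = D.M i)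
    (x : X) : σ (T.row (.inr i) j) x = (-1) ^ j * T.coef (.inr i) k x := by
  have hj : j < D.len (.inr i) := by simp only [JacobiDiagram.len]; omega
  have hk : k < D.len (.inr i) := by simp only [JacobiDiagram.len]; omega
  have : σ (T.row (.inr i) j) = ((-1 : ℝ) ^ j) • T.coef (.inr i) k := by
    refine T.basis.ext fun b => ?_
    obtain ⟨c, l⟩ := b
    rw [LinearMap.smul_apply, T.coef_of_lt hk, Module.Basis.repr_self, T.row_of_lt hj,
      T.pairing_eq, Finsupp.single_apply]
    rcases c with (c | c) | c
    · simp [JacobiDiagram.pairing]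
    · simp [JacobiDiagram.pairing]
    · by_cases hc : c = i
      · subst hc
        have : (j + (l : ℕ) = D.M c) ↔ l = ⟨k, hk⟩ := by
          rw [Fin.ext_iff]
          simp only
          omega
        simp [JacobiDiagram.pairing, this]
      · simp [JacobiDiagram.pairing, hc, Ne.symm hc]
  rw [this]
  rfl

/-- There may be no component of degree `0`, so the conformal factor of `φ (row q)` is computed on
the row of `τ_m`: its diagonal entries form an arithmetic progression with two zeros, hence all
vanish. -/
theorem apply_eq_zero_of_pos_half_row (hX : IsGradedSymplectic σ G) (T : SkewTableau D σ G δ)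
    (h4 : D.Cond4) {φ : X →ₗ[ℝ] Module.End ℝ X} {z : X}
    (hφ : IsFirstProlong σ (uFNonneg σ G δ) φ z) (i : Fin D.t) {q : ℕ} (hq : 2 * q < D.M i) :
    σ (T.row (.inr i) q) z = 0 := by
  set a : D.Row := .inr i with ha
  obtain ⟨n, hn⟩ : ∃ n, n = D.M i := ⟨_, rfl⟩
  have hlen : D.len a = n + 1 := by rw [hn]; rfl
  have hn5 := h4.five_le i
  obtain ⟨p, c, r, hE⟩ := T.entry_of_mem_uFNonneg hX (hφ.mem (T.row a q)) a
  -- By commutation the diagonal entry at `j` is the entry `(j, q)` of `φ (row j)`, which lies below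
  -- the diagonal.
  have hz : ∀ j < D.len a, q < j → j + q ≠ n → p + c * j = 0 := by
    intro j hj hqj hjn
    have hσ : σ (T.row a q) (T.row a j) = 0 := by
      by_contra h
      obtain ⟨i', h', h''⟩ := T.σ_row_same h
      obtain rfl : i = i' := by simpa [ha] using h'
      omega
    have h := hφ.comm (T.row a q) (T.row a j)
    rw [hσ, zero_smul, sub_eq_zero] at h
    have h1 := hE j hj j hj
    rw [if_pos rfl] at h1
    rw [← h1, entry, h]
    obtain ⟨p', c', r', hE'⟩ := T.entry_of_mem_uFNonneg hX (hφ.mem (T.row a j)) a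
    have h2 := hE' j hj q (by omega)
    rwa [if_neg (by omega), if_neg (by omega)] at h2
  have hpc : p = 0 ∧ c = 0 := by
    have key : ∀ j k : ℕ, j < k → k < D.len a → q < j → j + q ≠ n → k + q ≠ n →
        p = 0 ∧ c = 0 := by
      intro j k hjk hk hq hj' hk'
      have h1 := hz j (by omega) hq hj'
      have h2 := hz k hk (by omega) hk'
      have h3 : c * ((k : ℝ) - j) = 0 := by linarith
      have h4 : (k : ℝ) - j ≠ 0 := by
        have : (j : ℝ) < k := by exact_mod_cast hjk
        linarith
      have h5 := (mul_eq_zero.1 h3).resolve_right h4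
      rw [h5] at h1
      exact ⟨by linarith, h5⟩
    -- Two indices to the right of `q` and different from the box `n - q` paired with it.
    by_cases h0 : q = 0
    · exact key 1 2 (by omega) (by omega) (by omega) (by omega) (by omega)
    by_cases h1 : q = 1
    · exact key 2 n (by omega) (by omega) (by omega) (by omega) (by omega)
    · exact key (n - 1) n (by omega) (by omega) (by omega) (by omega) (by omega)
  have hdiag : ∀ j < D.len a, T.coef a j (φ (T.row a q) (T.row a j)) = 0 := by
    intro j hj
    have h1 := hE j hj j hj
    rw [if_pos rfl, hpc.1, hpc.2, zero_mul, zero_add] at h1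
    exact h1
  -- The end boxes are paired with each other, so the pairings on the left involve only the diagonal
  -- entries at `0` and `n`.
  have h := hφ.conformal (T.row a q) (T.row a 0) (T.row a n)
  have halt : ∀ x y, σ x y = -σ y x := fun x y => (LinearMap.IsAlt.neg hX.alt y x).symm
  rw [halt, T.σ_row_half i (j := n) (k := 0) (by omega), T.σ_row_half i (j := 0) (k := n) (by omega),
    T.σ_row_half i (j := 0) (k := n) (by omega), hdiag 0 (by omega), hdiag n (by omega),
    T.coef_row (by simp only [JacobiDiagram.len]; omega)] at h
  simp at h
  exact h

theorem apply_eq_zero_of_mem_positivePart (hX : IsGradedSymplectic σ G) (T : SkewTableau D σ G δ)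
    (h1 : D.Cond1) (h4 : D.Cond4) {φ : X →ₗ[ℝ] Module.End ℝ X} {z : X}
    (hφ : IsFirstProlong σ (uFNonneg σ G δ) φ z) {u : X} (hu : u ∈ positivePart G) :
    σ u z = 0 := by
  by_cases hr : Nonempty (Fin D.r)
  · obtain ⟨i⟩ := hr
    obtain ⟨s, hs⟩ := h1.even_S i
    have hl := h1.S_lt i
    have hj : s < D.len (.inl (.inl i)) := by simp only [JacobiDiagram.len]; omega
    have hk : D.l i - s < D.len (.inl (.inr i)) := by simp only [JacobiDiagram.len]; omega
    have e1 : D.deg ⟨.inl (.inl i), ⟨s, hj⟩⟩ = 0 := by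
      simp only [JacobiDiagram.deg, JacobiDiagram.top]
      omega
    have e2 : D.deg ⟨.inl (.inr i), ⟨D.l i - s, hk⟩⟩ = 0 := by
      simp only [JacobiDiagram.deg, JacobiDiagram.top]
      omega
    refine apply_eq_zero_of_pos_integer_row hX hφ (v := T.basis ⟨.inl (.inl i), ⟨s, hj⟩⟩)
      (w := T.basis ⟨.inl (.inr i), ⟨D.l i - s, hk⟩⟩) (e1 ▸ T.basis_mem _) (e2 ▸ T.basis_mem _)
      ?_ hu
    rw [T.pairing_eq]
    have : s + (D.l i - s) = D.l i := by omega
    simp [JacobiDiagram.pairing, this]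
  · have : positivePart G ≤ LinearMap.ker (σ.flip z) := by
      refine T.positivePart_le hX fun a j hj hpos => ?_
      rcases a with (i | i) | i
      · exact absurd ⟨i⟩ hr
      · exact absurd ⟨i⟩ hr
      · refine T.apply_eq_zero_of_pos_half_row hX h4 hφ i ?_
        simp only [JacobiDiagram.top] at hpos
        omega
    exact this hu

/-- Write `e_0` as the `s`-th shift of `e_s` and move the shifts to the other side. Since `A`
normalizes the line of the shift, they pass through `A` up to multiples of shifts, and `e_0` shifted
`s` times is zero because a nonrectangular upper row ends before degree `-s`. -/
theorem quadric_integer_box (T : SkewTableau D σ G δ)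
    {A : Module.End ℝ X} (hA : A ∈ flagProlong σ G δ 2) {i : Fin D.r} (hi : ¬ D.Rectangular i)
    {j : ℕ} (hj : 2 * j = D.S i) :
    σ (T.row (.inl (.inl i)) j) (A (T.row (.inl (.inl i)) j)) = 0 := by
  obtain ⟨c, hc⟩ := T.exists_smul_gen (T.bracket_gen_mem (n := 0) hA)
  set e := T.row (.inl (.inl i)) with he
  have hcomm : ∀ x, T.gen (A x) = A (T.gen x) - c • T.gen x := by
    intro x
    have := LinearMap.congr_fun hc x
    simp only [LinearMap.sub_apply, Module.End.mul_apply, LinearMap.smul_apply] at this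
    rw [← this]
    abel
  have hzero : ∀ k l : ℕ, D.l i < k + l → (T.gen ^ l) (A (e k)) = 0 := by
    intro k l
    induction l generalizing k with
    | zero =>
      intro h
      rw [he, T.row_of_le (by simp only [JacobiDiagram.len]; omega)]
      simp
    | succ l ih =>
      intro h
      rw [pow_succ, Module.End.mul_apply, hcomm, map_sub, map_smul, T.gen_row, T.gen_pow_row,
        ih (k + 1) (by omega), T.row_of_le (by simp only [JacobiDiagram.len]; omega)]
      simp
  have hskew : ∀ (l : ℕ) (x y : X), σ ((T.gen ^ l) x) y = (-1) ^ l * σ x ((T.gen ^ l) y) := by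
    intro l
    induction l with
    | zero => simp
    | succ l ih =>
      intro x y
      rw [pow_succ, Module.End.mul_apply, ih, T.σ_gen, ← Module.End.mul_apply, ← pow_succ',
        pow_succ]
      ring
  have hej : e j = (T.gen ^ j) (e 0) := by rw [he, T.gen_pow_row, zero_add]
  have hlt : D.l i < j + j := by
    have := D.l_le i
    have : D.l i ≠ D.S i := hi
    omega
  nth_rewrite 1 [hej]
  rw [hskew, hzero j j hlt, map_zero, mul_zero]

theorem quadric_positivePart (hX : IsGradedSymplectic σ G) {A : Module.End ℝ X}
    (hA : A ∈ uFNonneg σ G δ) {u v : X} (hu : u ∈ positivePart G) (hv : v ∈ degFiltration G 0) :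
    σ u (A v) = 0 ∧ σ v (A u) = 0 := by
  rw [positivePart_eq_degFiltration] at hu
  exact ⟨hX.apply_eq_zero_of_degFiltration (by norm_num) hu (uFNonneg_apply_mem hA hv),
    hX.apply_eq_zero_of_degFiltration (by norm_num) hv (uFNonneg_apply_mem hA hu)⟩

theorem quadric_frakL (hX : IsGradedSymplectic σ G) (T : SkewTableau D σ G δ)
    {A : Module.End ℝ X} (hA : A ∈ uFNonneg σ G δ) (i : Fin D.r ⊕ Fin D.t) {u : X}
    (hu : u ∈ T.frakL i) : σ u (A u) = 0 := by
  have hpos : ∀ u ∈ positivePart G, σ u (A u) = 0 := fun u hu =>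
    (quadric_positivePart hX hA hu (degFiltration_anti G (by norm_num) hu)).1
  rcases i with i | i
  · by_cases hi : D.Rectangular i
    · rw [frakL, if_pos hi] at hu
      exact hpos u hu
    · rw [frakL, if_neg hi] at hu
      obtain ⟨v, hv, w, hw, rfl⟩ := Submodule.mem_sup.1 hu
      -- The spanning set has at most one element, since the degree determines the box in a row.
      have hw' : ∃ (c : ℝ) (j : ℕ), 2 * j = D.S i ∧ w = c • T.row (.inl (.inl i)) j ∨ w = 0 := by
        clear hu
        induction hw using Submodule.span_induction with
        | zero => exact ⟨0, 0, Or.inr rfl⟩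
        | mem x hx =>
          obtain ⟨j, hj, rfl⟩ := hx
          refine ⟨1, j, Or.inl ⟨?_, ?_⟩⟩
          · simp only [JacobiDiagram.deg, JacobiDiagram.top] at hj
            omega
          · rw [one_smul, T.basis_eq_row]
        | add x y _ _ hx hy =>
          obtain ⟨c, j, ⟨hj, rfl⟩ | rfl⟩ := hx
          · obtain ⟨c', j', ⟨hj', rfl⟩ | rfl⟩ := hy
            · obtain rfl : j = j' := by omega
              exact ⟨c + c', j, Or.inl ⟨hj, by rw [add_smul]⟩⟩
            · exact ⟨c, j, Or.inl ⟨hj, by simp⟩⟩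
          · simpa using hy
        | smul t x _ hx =>
          obtain ⟨c, j, ⟨hj, rfl⟩ | rfl⟩ := hx
          · exact ⟨t * c, j, Or.inl ⟨hj, by rw [mul_smul]⟩⟩
          · exact ⟨0, 0, Or.inr (by simp)⟩
      obtain ⟨c, j, ⟨hj, rfl⟩ | rfl⟩ := hw'
      · set e := T.row (.inl (.inl i)) j with he
        have he0 : e ∈ G 0 := by
          have := T.row_mem (.inl (.inl i)) j
          have h0 : D.top (.inl (.inl i)) - 2 * (j : ℤ) = 0 := by
            simp only [JacobiDiagram.top]
            omega
          rwa [h0] at this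
        obtain ⟨h1, h2⟩ := quadric_positivePart hX hA hv (le_degFiltration G le_rfl he0)
        have h3 : σ e (A e) = 0 := by
          have : uFNonneg σ G δ ≤ LinearMap.ker (σ e ∘ₗ LinearMap.applyₗ e) := by
            refine iSup_le fun n B hB => ?_
            -- A part of positive degree moves `e_0` to a degree orthogonal to degree `0`; only the
            -- part of degree `0` needs the shape of the component.
            rcases Nat.eq_zero_or_pos n with rfl | hn
            · exact T.quadric_integer_box hB hi hj
            · exact hX.orthogonal 0 (0 + n) (by omega) e he0 _ (flagProlong_le_endGr n hB 0 e he0)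
          exact this hA
        simp only [map_add, map_smul, LinearMap.add_apply, LinearMap.smul_apply, hpos v hv, h1, h2,
          h3, smul_eq_mul]
        ring
      · rw [add_zero]
        exact hpos v hv
  · exact hpos u hu

end SkewTableau

end Quadrics

/-! ### Exponentials of nilpotent endomorphisms and conjugation -/

section Exponential

variable {X : Type u} [AddCommGroup X] [Module ℝ X]

theorem expNilpotent_eq_sum {x : Module.End ℝ X} {k : ℕ} (h : x ^ k = 0) :
    expNilpotent x = ∑ j ∈ Finset.range k, ((j.factorial : ℝ)⁻¹) • x ^ j := by
  let _ : Module ℚ (Module.End ℝ X) := Module.compHom _ (algebraMap ℚ ℝ)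
  have h1 : ∀ n : ℕ, ∑ j ∈ Finset.range n, ((j.factorial : ℝ)⁻¹) • x ^ j =
      ∑ j ∈ Finset.range n, ((j.factorial : ℚ)⁻¹) • x ^ j := fun n =>
    Finset.sum_congr rfl fun j _ => by
      rw [← Rat.cast_smul_eq_qsmul ℝ]
      push_cast
      rfl
  rw [expNilpotent, h1, h1, ← IsNilpotent.exp_eq_sum h]
  rfl

theorem expNilpotent_add {x y : Module.End ℝ X} (hxy : Commute x y) (hx : IsNilpotent x)
    (hy : IsNilpotent y) : expNilpotent (x + y) = expNilpotent x * expNilpotent y := by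
  let _ : Module ℚ (Module.End ℝ X) := Module.compHom _ (algebraMap ℚ ℝ)
  have h1 : ∀ z : Module.End ℝ X, IsNilpotent z → expNilpotent z = IsNilpotent.exp z := by
    rintro z -
    refine Finset.sum_congr rfl fun j _ => ?_
    rw [← Rat.cast_smul_eq_qsmul ℝ]
    push_cast
    rfl
  rw [h1 _ hx, h1 _ hy, h1 _ (hxy.isNilpotent_add hx hy), IsNilpotent.exp_add_of_commute hxy hx hy]

theorem expNilpotent_zero : expNilpotent (0 : Module.End ℝ X) = 1 := by
  rw [expNilpotent_eq_sum (k := 1) (by simp)]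
  simp

theorem expNilpotent_neg_mul {x : Module.End ℝ X} (hx : IsNilpotent x) :
    expNilpotent (-x) * expNilpotent x = 1 := by
  rw [← expNilpotent_add (Commute.neg_left (Commute.refl x)) hx.neg hx, neg_add_cancel,
    expNilpotent_zero]

theorem expNilpotent_mul_neg {x : Module.End ℝ X} (hx : IsNilpotent x) :
    expNilpotent x * expNilpotent (-x) = 1 := by
  rw [← expNilpotent_add (Commute.neg_right (Commute.refl x)) hx hx.neg, add_neg_cancel,
    expNilpotent_zero]

theorem expNilpotent_apply_mem {x : Module.End ℝ X} {N : Submodule ℝ X}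
    (h : ∀ v ∈ N, x v ∈ N) {v : X} (hv : v ∈ N) : expNilpotent x v ∈ N := by
  rw [expNilpotent, LinearMap.sum_apply]
  refine Submodule.sum_mem _ fun j hj => Submodule.smul_mem _ _ ?_
  clear hj
  induction j with
  | zero => exact hv
  | succ j ih =>
    rw [pow_succ', Module.End.mul_apply]
    exact h _ ih

/-- A subspace of endomorphisms stable under the bracket with a nilpotent endomorphism is stable
under the conjugation by its exponential. -/
theorem expNilpotent_conj_mem {x : Module.End ℝ X} (hx : IsNilpotent x)
    {N : Submodule ℝ (Module.End ℝ X)} (h : ∀ A ∈ N, A * x - x * A ∈ N) {A : Module.End ℝ X}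
    (hA : A ∈ N) : expNilpotent (-x) * A * expNilpotent x ∈ N := by
  obtain ⟨k, hk⟩ := hx
  have hk' : (-x) ^ k = 0 := by rw [neg_pow, hk, mul_zero]
  have hL : (LinearMap.mulLeft ℝ (-x)) ^ k = 0 := by
    rw [LinearMap.pow_mulLeft, hk', LinearMap.mulLeft_zero_eq_zero]
  have hR : (LinearMap.mulRight ℝ x) ^ k = 0 := by
    rw [LinearMap.pow_mulRight, hk, LinearMap.mulRight_zero_eq_zero]
  -- Conjugation is the exponential of `B ↦ B x - x B`, a sum of two commuting nilpotent operators;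
  -- a subspace stable under the operator is stable under its exponential.
  have hcomm : Commute (LinearMap.mulLeft ℝ (-x)) (LinearMap.mulRight ℝ x) :=
    LinearMap.commute_mulLeft_right _ _
  have h1 := expNilpotent_add hcomm ⟨k, hL⟩ ⟨k, hR⟩
  have h2 : expNilpotent (-x) * A * expNilpotent x =
      expNilpotent (LinearMap.mulLeft ℝ (-x) + LinearMap.mulRight ℝ x) A := by
    rw [h1, Module.End.mul_apply]
    have hr : expNilpotent (LinearMap.mulRight ℝ x) A = A * expNilpotent x := by
      rw [expNilpotent_eq_sum hR, expNilpotent_eq_sum hk, LinearMap.sum_apply, Finset.mul_sum]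
      refine Finset.sum_congr rfl fun j _ => ?_
      rw [LinearMap.pow_mulRight, LinearMap.smul_apply, LinearMap.mulRight_apply, mul_smul_comm]
    have hl : ∀ B, expNilpotent (LinearMap.mulLeft ℝ (-x)) B = expNilpotent (-x) * B := by
      intro B
      rw [expNilpotent_eq_sum hL, expNilpotent_eq_sum hk', LinearMap.sum_apply, Finset.sum_mul]
      refine Finset.sum_congr rfl fun j _ => ?_
      rw [LinearMap.pow_mulLeft, LinearMap.smul_apply, LinearMap.mulLeft_apply, smul_mul_assoc]
    rw [hr, hl, mul_assoc]
  rw [h2]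
  refine expNilpotent_apply_mem (fun B hB => ?_) hA
  rw [LinearMap.add_apply, LinearMap.mulLeft_apply, LinearMap.mulRight_apply, neg_mul,
    neg_add_eq_sub]
  exact h B hB

/-- The exponential of a nilpotent element of the symplectic algebra. -/
theorem σ_expNilpotent_left {σ : LinearMap.BilinForm ℝ X} {x : Module.End ℝ X}
    (hx : IsNilpotent x) (h : ∀ v w, σ (x v) w = -σ v (x w)) (v w : X) :
    σ (expNilpotent x v) w = σ v (expNilpotent (-x) w) := by
  obtain ⟨k, hk⟩ := hx
  have hk' : (-x) ^ k = 0 := by rw [neg_pow, hk, mul_zero]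
  have hj : ∀ (j : ℕ) (v w : X), σ ((x ^ j) v) w = σ v (((-x) ^ j) w) := by
    intro j
    induction j with
    | zero => simp
    | succ j ih =>
      intro v w
      rw [pow_succ, Module.End.mul_apply, ih, h, pow_succ', Module.End.mul_apply,
        LinearMap.neg_apply, map_neg]
  simp only [expNilpotent_eq_sum hk, expNilpotent_eq_sum hk', LinearMap.sum_apply, map_sum,
    LinearMap.smul_apply, map_smul, hj]

theorem σ_expNilpotent {σ : LinearMap.BilinForm ℝ X} {x : Module.End ℝ X}
    (hx : IsNilpotent x) (h : ∀ v w, σ (x v) w = -σ v (x w)) (v w : X) :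
    σ (expNilpotent x v) (expNilpotent x w) = σ v w := by
  rw [σ_expNilpotent_left hx h, ← Module.End.mul_apply, expNilpotent_neg_mul hx,
    Module.End.one_apply]

/-- The first prolongation of a subspace stable under the bracket with a nilpotent element of the
symplectic algebra is stable under the exponential of this element. -/
theorem IsFirstProlong.conj {σ : LinearMap.BilinForm ℝ X} {g : Submodule ℝ (Module.End ℝ X)}
    {φ : X →ₗ[ℝ] Module.End ℝ X} {z : X} (hφ : IsFirstProlong σ g φ z) {x : Module.End ℝ X}
    (hx : IsNilpotent x) (hσ : ∀ v w, σ (x v) w = -σ v (x w))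
    (hg : ∀ A ∈ g, A * x - x * A ∈ g) :
    IsFirstProlong σ g (LinearMap.mulRight ℝ (expNilpotent x) ∘ₗ
      LinearMap.mulLeft ℝ (expNilpotent (-x)) ∘ₗ φ ∘ₗ expNilpotent x) (expNilpotent (-x) z) := by
  have hinv : ∀ v, expNilpotent (-x) (expNilpotent x v) = v := fun v => by
    rw [← Module.End.mul_apply, expNilpotent_neg_mul hx, Module.End.one_apply]
  have hinv' : ∀ v, expNilpotent x (expNilpotent (-x) v) = v := fun v => by
    rw [← Module.End.mul_apply, expNilpotent_mul_neg hx, Module.End.one_apply]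
  have happ : ∀ v w, (LinearMap.mulRight ℝ (expNilpotent x) ∘ₗ
      LinearMap.mulLeft ℝ (expNilpotent (-x)) ∘ₗ φ ∘ₗ expNilpotent x) v w =
      expNilpotent (-x) (φ (expNilpotent x v) (expNilpotent x w)) := fun v w => rfl
  refine ⟨fun v => expNilpotent_conj_mem hx hg (hφ.mem _), fun v w => ?_, fun u v w => ?_⟩
  · rw [happ, happ, ← map_sub, hφ.comm, map_smul, σ_expNilpotent hx hσ]
  · have hm : ∀ a b, σ (expNilpotent (-x) a) b = σ a (expNilpotent x b) := fun a b => by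
      rw [← σ_expNilpotent hx hσ, hinv']
    have hm' : ∀ a b, σ a (expNilpotent (-x) b) = σ (expNilpotent x a) b := fun a b => by
      rw [← σ_expNilpotent hx hσ, hinv']
    rw [happ, happ, hm, hm', hm', hφ.conformal, σ_expNilpotent hx hσ]

end Exponential

/-! ### Translates by `e^x` and the main properties of the first prolongation -/

section Orbit

variable {X : Type u} [AddCommGroup X] [Module ℝ X] {σ : LinearMap.BilinForm ℝ X}
  {G : ℤ → Submodule ℝ X} {δ : Submodule ℝ (Module.End ℝ X)} {D : JacobiDiagram}

namespace SkewTableau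

theorem gen_pow_eq_zero (T : SkewTableau D σ G δ) : ∃ k, T.gen ^ k = 0 := by
  refine ⟨∑ a, D.len a, T.linearMap_ext_row fun a j => ?_⟩
  rw [T.gen_pow_row, LinearMap.zero_apply, T.row_of_le]
  have := Finset.single_le_sum (f := fun a => D.len a) (fun a _ => Nat.zero_le _)
    (Finset.mem_univ a)
  exact this.trans (Nat.le_add_left _ _)

theorem isNilpotent_of_mem (T : SkewTableau D σ G δ) {x : Module.End ℝ X} (hx : x ∈ δ) :
    IsNilpotent x := by
  obtain ⟨t, rfl⟩ := T.exists_smul_gen hx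
  obtain ⟨k, hk⟩ := T.gen_pow_eq_zero
  exact ⟨k, by rw [smul_pow, hk, smul_zero]⟩

theorem σ_of_mem (T : SkewTableau D σ G δ) {x : Module.End ℝ X} (hx : x ∈ δ) (v w : X) :
    σ (x v) w = -σ v (x w) := by
  obtain ⟨t, rfl⟩ := T.exists_smul_gen hx
  simp [T.σ_gen]

theorem bracket_mem_uF (T : SkewTableau D σ G δ) {x : Module.End ℝ X} (hx : x ∈ δ)
    {A : Module.End ℝ X} (hA : A ∈ uF σ G δ) : A * x - x * A ∈ uF σ G δ := by
  have h : uF σ G δ ≤ bracketInto δ (uF σ G δ) := by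
    refine iSup_le fun n A hA x hx => ?_
    rcases n with _ | _ | n
    · obtain ⟨s, rfl⟩ := T.exists_smul_gen hx
      obtain ⟨t, rfl⟩ := T.exists_smul_gen hA
      simp [smul_smul, mul_comm s t]
    · have : A = 0 := hA
      simp [this]
    · exact le_iSup (flagProlong σ G δ) n (hA.2 x hx)
  exact h hA x hx

/-- The translates of the space of positive degree by the exponentials of the elements of the
symbol span the space. -/
theorem eq_top_of_forall_expNilpotent (T : SkewTableau D σ G δ) (h1 : D.Cond1) {N : Submodule ℝ X}
    (hN : ∀ x ∈ δ, ∀ u ∈ positivePart G, expNilpotent x u ∈ N) : N = ⊤ := by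
  obtain ⟨k, hk⟩ := T.gen_pow_eq_zero
  refine eq_top_iff.2 fun v _ => T.mem_of_forall_row (fun a j hj => ?_) v
  by_contra hmem
  obtain ⟨f, hf, hfN⟩ := Submodule.exists_le_ker_of_notMem hmem
  have hu : T.row a 0 ∈ positivePart G := by
    rw [positivePart_eq_degFiltration]
    have := JacobiDiagram.top_pos h1 a
    exact le_degFiltration G (by push_cast; omega) (T.row_mem a 0)
  -- The curve `t ↦ e^{t gen} (row a 0)` is polynomial with coefficients `row a j / j!`. A
  -- functional `f` that vanishes on the curve vanishes on all of them.
  have hp : (∑ j ∈ Finset.range k, Polynomial.C ((j.factorial : ℝ)⁻¹ * f (T.row a j)) *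
      Polynomial.X ^ j) = 0 := by
    refine Polynomial.funext fun t => ?_
    have h := hfN (hN (t • T.gen) (Submodule.smul_mem _ _ T.gen_mem) _ hu)
    rw [LinearMap.mem_ker, expNilpotent_eq_sum (k := k) (by rw [smul_pow, hk, smul_zero])] at h
    rw [Polynomial.eval_finsetSum, Polynomial.eval_zero, ← h, LinearMap.sum_apply, map_sum]
    refine Finset.sum_congr rfl fun j _ => ?_
    rw [LinearMap.smul_apply, smul_pow, LinearMap.smul_apply, T.gen_pow_row, zero_add, map_smul,
      map_smul]
    simp
    ring
  have hjk : j < k := by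
    by_contra hkj
    refine hf ?_
    have : T.row a j = (T.gen ^ (j - k)) ((T.gen ^ k) (T.row a 0)) := by
      rw [T.gen_pow_row, T.gen_pow_row]
      congr 1
      omega
    rw [this, hk]
    simp
  have hc := congrArg (fun p => Polynomial.coeff p j) hp
  simp only [Polynomial.finsetSum_coeff, Polynomial.coeff_C_mul, Polynomial.coeff_X_pow,
    Polynomial.coeff_zero] at hc
  rw [Finset.sum_eq_single j] at hc
  · rw [if_pos rfl, mul_one] at hc
    exact hf ((mul_eq_zero.1 hc).resolve_left (by positivity))
  · intro b _ hb
    rw [if_neg (Ne.symm hb), mul_zero]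
  · intro h
    exact absurd (Finset.mem_range.2 hjk) h

/-- The main properties of the first prolongation: its elements vanish on `y`, and their values
satisfy quadratic equations on the translates of the spaces `𝔏_i`. -/
theorem firstProlong_main (T : SkewTableau D σ G δ) (hX : IsGradedSymplectic σ G) (h1 : D.Cond1)
    (h3 : D.Cond3) (h4 : D.Cond4) {φ : X →ₗ[ℝ] Module.End ℝ X} {z : X}
    (hφ : IsFirstProlong σ (uF σ G δ) φ z) : z = 0 ∧
      ∀ (i : Fin D.r ⊕ Fin D.t), ∀ x ∈ δ, ∀ u ∈ T.frakL i, ∀ w,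
        σ (expNilpotent x u) (φ w (expNilpotent x u)) = 0 := by
  -- The prolongation is transported by `e^{-x}` rather than the subspace by `e^x`: the results at
  -- `x = 0` then apply to every translate.
  have hconj := fun x (hx : x ∈ δ) => hφ.conj (T.isNilpotent_of_mem hx) (T.σ_of_mem hx)
    (fun A => T.bracket_mem_uF hx)
  have hconj' := fun x (hx : x ∈ δ) =>
    (⟨T.firstProlong_mem_uFNonneg hX h1 h3 h4 (hconj x hx), (hconj x hx).comm,
      (hconj x hx).conformal⟩ : IsFirstProlong σ (uFNonneg σ G δ) _ _)
  constructor
  · have hN : LinearMap.ker (σ.flip z) = ⊤ := by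
      refine T.eq_top_of_forall_expNilpotent h1 fun x hx u hu => ?_
      have := T.apply_eq_zero_of_mem_positivePart hX h1 h4 (hconj' x hx) hu
      rwa [← σ_expNilpotent_left (T.isNilpotent_of_mem hx) (T.σ_of_mem hx)] at this
    refine hX.nondegenerate.2 z fun v => ?_
    have : v ∈ LinearMap.ker (σ.flip z) := hN ▸ Submodule.mem_top
    exact this
  · intro i x hx u hu w
    have hnil := T.isNilpotent_of_mem hx
    have h := T.quadric_frakL hX ((hconj' x hx).mem (expNilpotent (-x) w)) i hu
    have e : expNilpotent x (expNilpotent (-x) w) = w := by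
      rw [← Module.End.mul_apply, expNilpotent_mul_neg hnil, Module.End.one_apply]
    rw [σ_expNilpotent_left hnil (T.σ_of_mem hx)]
    have e' : (LinearMap.mulRight ℝ (expNilpotent x) ∘ₗ LinearMap.mulLeft ℝ (expNilpotent (-x)) ∘ₗ
      φ ∘ₗ expNilpotent x) (expNilpotent (-x) w) u =
      expNilpotent (-x) (φ (expNilpotent x (expNilpotent (-x) w)) (expNilpotent x u)) := rfl
    rwa [e', e] at h

end SkewTableau

end Orbit

/-! ### Multilinear forms of elements of the ambient space and their polarization -/

section TanakaForms

variable {X : Type u} [AddCommGroup X] [Module ℝ X]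

theorem ambient_one_ext {f : ambient X 1} (h : ∀ v, onX 0 f v = 0) (h' : scaleY f = 0) : f = 0 :=
  Prod.ext (LinearMap.ext h) h'

theorem ambient_ext {n : ℕ} {f : ambient X (n + 2)} (h : ∀ v, onX (n + 1) f v = 0)
    (h' : onY n f = 0) : f = 0 :=
  Prod.ext (LinearMap.ext h) h'

/-- The multilinear form `(v₀, …, vₙ) ↦ σ(vₙ, [… [[f, v₀], v₁] …, vₙ₋₁])` of an element `f` of
degree `n - 1`. -/
noncomputable def tanakaForm (σ : LinearMap.BilinForm ℝ X) :
    (n : ℕ) → ambient X n →ₗ[ℝ] MultilinearMap ℝ (fun _ : Fin (n + 1) => X) ℝ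
  | 0 => (MultilinearMap.ofSubsingletonₗ ℝ ℝ X ℝ (0 : Fin 1)).toLinearMap ∘ₗ σ.flip ∘ₗ asVector
  | n + 1 => (multilinearCurryLeftEquiv ℝ (fun _ : Fin (n + 2) => X) ℝ).symm.toLinearMap ∘ₗ
      LinearMap.llcomp ℝ X (ambient X n) _ (tanakaForm σ n) ∘ₗ onX n

variable {σ : LinearMap.BilinForm ℝ X}

theorem tanakaForm_zero (f : ambient X 0) (x : Fin 1 → X) :
    tanakaForm σ 0 f x = σ (x 0) (asVector f) := rfl

theorem tanakaForm_succ (n : ℕ) (f : ambient X (n + 1)) (x : Fin (n + 2) → X) :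
    tanakaForm σ (n + 1) f x = tanakaForm σ n (onX n f (x 0)) (Fin.tail x) := rfl

theorem tanakaForm_const (n : ℕ) (f : ambient X n) (v : X) :
    tanakaForm σ n f (fun _ => v) = σ v (diagonal n f v) := by
  induction n with
  | zero => rfl
  | succ n ih =>
    rw [tanakaForm_succ, diagonal]
    exact ih (onX n f v)

/-- The elements of the ambient space with symmetric multilinear forms. -/
def IsSymmetricElement (σ : LinearMap.BilinForm ℝ X) : (n : ℕ) → ambient X n → Prop
  | 0 => fun _ => True
  | 1 => fun f => ∀ v w, σ w (asVector (onX 0 f v)) = σ v (asVector (onX 0 f w))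
  | n + 2 => fun f => (∀ v, IsSymmetricElement σ (n + 1) (onX (n + 1) f v)) ∧
      ∀ v w, onX n (onX (n + 1) f v) w = onX n (onX (n + 1) f w) v

theorem IsSymmetricElement.onX {n : ℕ} {f : ambient X (n + 1)}
    (hf : IsSymmetricElement σ (n + 1) f) (v : X) : IsSymmetricElement σ n (onX n f v) := by
  cases n with
  | zero => trivial
  | succ n => exact hf.1 v

theorem Fin.tail_comp_swap_succ {α : Type*} {n : ℕ} (x : Fin (n + 1) → α) (i j : Fin n) :
    Fin.tail (x ∘ Equiv.swap i.succ j.succ) = Fin.tail x ∘ Equiv.swap i j := by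
  funext k
  simp only [Fin.tail, Function.comp_apply]
  congr 1
  simp only [Equiv.swap_apply_def, Fin.succ_inj]
  split_ifs <;> rfl

/-- Swapping the first two arguments is commutation of the first two brackets, or the symplectic
condition when only two arguments are left; other swaps reduce to `[f, v₀]`. -/
theorem IsSymmetricElement.tanakaForm_swap {n : ℕ} {f : ambient X n}
    (hf : IsSymmetricElement σ n f) (i : Fin n) (x : Fin (n + 1) → X) :
    tanakaForm σ n f (x ∘ Equiv.swap i.castSucc i.succ) = tanakaForm σ n f x := by
  induction n with
  | zero => exact i.elim0
  | succ n ih =>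
    refine Fin.cases ?_ (fun j => ?_) i
    · cases n with
      | zero => exact hf (x 1) (x 0)
      | succ n =>
        have e : Fin.tail (Fin.tail (x ∘ Equiv.swap (0 : Fin (n + 3)) 1)) =
            Fin.tail (Fin.tail x) := by
          funext k
          have h1 : k.succ.succ ≠ (1 : Fin (n + 3)) := by
            rw [← Fin.succ_zero_eq_one]
            exact fun e => Fin.succ_ne_zero k (Fin.succ_injective _ e)
          simp only [Fin.tail, Function.comp_apply]
          rw [Equiv.swap_apply_of_ne_of_ne (Fin.succ_ne_zero _) h1]
        simp only [Fin.castSucc_zero, Fin.succ_zero_eq_one]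
        rw [tanakaForm_succ, tanakaForm_succ, tanakaForm_succ, tanakaForm_succ, e]
        have h2 : (x ∘ Equiv.swap (0 : Fin (n + 3)) 1) 0 = x 1 := by simp
        have h3 : Fin.tail (x ∘ Equiv.swap (0 : Fin (n + 3)) 1) 0 = x 0 := by simp [Fin.tail]
        have h4 : Fin.tail x 0 = x 1 := rfl
        rw [h2, h3, h4, hf.2]
    · rw [tanakaForm_succ, tanakaForm_succ, ← Fin.succ_castSucc, Fin.tail_comp_swap_succ]
      have h2 : (x ∘ Equiv.swap j.castSucc.succ j.succ.succ) 0 = x 0 := by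
        simp only [Function.comp_apply]
        rw [Equiv.swap_apply_of_ne_of_ne (Fin.succ_ne_zero _).symm (Fin.succ_ne_zero _).symm]
      rw [h2]
      exact ih (hf.onX _) j _

theorem IsSymmetricElement.tanakaForm_perm {n : ℕ} {f : ambient X n}
    (hf : IsSymmetricElement σ n f) (π : Equiv.Perm (Fin (n + 1))) (x : Fin (n + 1) → X) :
    tanakaForm σ n f (x ∘ π) = tanakaForm σ n f x := by
  have hπ : π ∈ Submonoid.closure
      (Set.range fun i : Fin n => Equiv.swap i.castSucc i.succ) := by
    rw [Equiv.Perm.mclosure_swap_castSucc_succ]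
    exact Submonoid.mem_top π
  induction hπ using Submonoid.closure_induction generalizing x with
  | mem _ h =>
    obtain ⟨i, rfl⟩ := h
    exact hf.tanakaForm_swap i x
  | one => rfl
  | mul a b _ _ iha ihb =>
    rw [Equiv.Perm.coe_mul, ← Function.comp_assoc, ihb, iha]

/-- The values of the form of a symmetric element on a line are given by a polynomial whose linear
coefficient is a partial polarization. -/
theorem IsSymmetricElement.exists_polynomial {n : ℕ} {f : ambient X n}
    (hf : IsSymmetricElement σ n f) (v w : X) :
    ∃ p : Polynomial ℝ, (∀ s, tanakaForm σ n f (fun _ => v + s • w) = p.eval s) ∧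
      p.coeff 0 = tanakaForm σ n f (fun _ => v) ∧
      p.coeff 1 = (n + 1) * tanakaForm σ n f (Fin.cons w fun _ => v) := by
  induction n with
  | zero =>
    refine ⟨Polynomial.C (σ v (asVector f)) + Polynomial.X * Polynomial.C (σ w (asVector f)),
      fun s => ?_, ?_, ?_⟩
    · simp only [tanakaForm_zero, map_add, map_smul, LinearMap.add_apply, LinearMap.smul_apply,
        smul_eq_mul, Polynomial.eval_add, Polynomial.eval_C, Polynomial.eval_mul,
        Polynomial.eval_X]
    · simp [tanakaForm_zero]
    · simp [tanakaForm_zero, Polynomial.coeff_C]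
  | succ n ih =>
    obtain ⟨p, hp, hp0, hp1⟩ := ih (hf.onX v)
    obtain ⟨q, hq, hq0, hq1⟩ := ih (hf.onX w)
    refine ⟨p + Polynomial.X * q, fun s => ?_, ?_, ?_⟩
    · rw [tanakaForm_succ, map_add, map_smul, map_add, map_smul, add_apply, smul_apply]
      have e : Fin.tail (fun _ : Fin (n + 2) => v + s • w) = fun _ => v + s • w := rfl
      rw [e, hp, hq]
      simp
    · rw [Polynomial.coeff_add, Polynomial.coeff_X_mul_zero, hp0, add_zero]
      rfl
    · have e1 : tanakaForm σ n (_root_.onX n f v) (Fin.cons w fun _ => v) =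
          tanakaForm σ n (_root_.onX n f w) (fun _ => v) := by
        have h := hf.tanakaForm_swap 0 (Fin.cons w fun _ => v)
        rw [tanakaForm_succ, tanakaForm_succ] at h
        simp only [Fin.castSucc_zero, Fin.succ_zero_eq_one] at h
        have h1 : ((Fin.cons w fun _ => v : Fin (n + 2) → X) ∘ Equiv.swap 0 1) 0 = v := by
          simp only [Function.comp_apply, Equiv.swap_apply_left]
          rfl
        have h2 : Fin.tail ((Fin.cons w fun _ => v : Fin (n + 2) → X) ∘ Equiv.swap 0 1) =
            Fin.cons w fun _ => v := by
          funext k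
          refine Fin.cases ?_ (fun k => ?_) k
          · simp [Fin.tail]
          · have h1 : k.succ.succ ≠ (1 : Fin (n + 2)) := by
              simp [Fin.ext_iff]
            simp only [Fin.tail, Function.comp_apply]
            rw [Equiv.swap_apply_of_ne_of_ne (Fin.succ_ne_zero _) h1]
            rfl
        rw [h1, h2, Fin.cons_zero, Fin.tail_cons] at h
        exact h
      have e2 : tanakaForm σ (n + 1) f (Fin.cons w fun _ => v) =
          tanakaForm σ n (_root_.onX n f w) (fun _ => v) := rfl
      have e3 : (Polynomial.X * q).coeff 1 = q.coeff 0 := Polynomial.coeff_X_mul q 0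
      rw [Polynomial.coeff_add, e3, hp1, hq0, e1, e2]
      push_cast
      ring

/-- The derivative of the polynomial of `f` in the direction `w` is a nonzero multiple of the
polynomial of `[f, w]`. This lets injectivity be proved by induction on the degree. -/
theorem IsSymmetricElement.tanakaForm_onX_const {n : ℕ} {f : ambient X (n + 1)}
    (hf : IsSymmetricElement σ (n + 1) f) (h : ∀ v, tanakaForm σ (n + 1) f (fun _ => v) = 0)
    (w v : X) : tanakaForm σ n (_root_.onX n f w) (fun _ => v) = 0 := by
  obtain ⟨p, hp, -, hp1⟩ := hf.exists_polynomial v w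
  have hp0 : p = 0 := Polynomial.funext fun s => by rw [← hp, h, Polynomial.eval_zero]
  rw [hp0, Polynomial.coeff_zero] at hp1
  have : ((n + 1 : ℕ) : ℝ) + 1 ≠ 0 := by positivity
  exact (mul_eq_zero.1 hp1.symm).resolve_left this

/-- If two arguments of the form of a symmetric element coincide, these arguments can be moved to
the last two places. -/
theorem IsSymmetricElement.tanakaForm_eq_zero_of_eq {n : ℕ} {f : ambient X (n + 1)}
    (hf : IsSymmetricElement σ (n + 1) f) {u : X}
    (h : ∀ x : Fin (n + 2) → X, x (Fin.last (n + 1)) = u → x (Fin.last n).castSucc = u →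
      tanakaForm σ (n + 1) f x = 0) {x : Fin (n + 2) → X} {i j : Fin (n + 2)} (hij : i ≠ j)
    (hi : x i = u) (hj : x j = u) : tanakaForm σ (n + 1) f x = 0 := by
  set l := Fin.last (n + 1) with hl
  set c := (Fin.last n).castSucc with hc
  have hlc : l ≠ c := by simp [hl, hc, Fin.ext_iff]
  set j' := Equiv.swap l i j with hj'
  have hlj : l ≠ j' := by
    intro e
    have e1 : Equiv.swap l i l = j := by
      have := congrArg (Equiv.swap l i) e
      rwa [hj', Equiv.swap_apply_self] at this
    rw [Equiv.swap_apply_left] at e1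
    exact hij e1
  rw [← hf.tanakaForm_perm (Equiv.swap l i * Equiv.swap c j')]
  refine h _ ?_ ?_
  · rw [Function.comp_apply, Equiv.Perm.mul_apply, Equiv.swap_apply_of_ne_of_ne hlc hlj,
      Equiv.swap_apply_left, hi]
  · rw [Function.comp_apply, Equiv.Perm.mul_apply, Equiv.swap_apply_left, hj',
      Equiv.swap_apply_self, hj]

end TanakaForms

/-! ### Symmetry, injectivity and vanishing for Tanaka prolongations -/

section Tanaka

variable {X : Type u} [AddCommGroup X] [Module ℝ X] {σ : LinearMap.BilinForm ℝ X}
  {g : Submodule ℝ (Module.End ℝ X)}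

theorem isFirstProlong_of_mem_tanaka {f : ambient X 2} (hf : f ∈ tanaka σ g 1) :
    IsFirstProlong σ g (onX 0 ∘ₗ onX 1 f) (asVector (onY 0 f)) := by
  refine ⟨fun v => (hf.1 v).1, fun v w => (hf.2.1 v w).symm, fun u v w => ?_⟩
  have h1 := (hf.1 u).2 v w
  have h2 : scaleY (onX 1 f u) = -σ u (asVector (onY 0 f)) := by
    have := hf.2.2 u
    linarith
  rw [h2] at h1
  rw [mul_comm, h1]
  rfl

theorem tanaka_onX_mem {n : ℕ} {f : ambient X (n + 2)} (hf : f ∈ tanaka σ g (n + 1)) (v : X) :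
    onX (n + 1) f v ∈ tanaka σ g n := by
  cases n with
  | zero => exact hf.1 v
  | succ n => exact hf.1 v

theorem tanaka_comm {n : ℕ} {f : ambient X (n + 2)} (hf : f ∈ tanaka σ g (n + 1)) (v w : X) :
    σ v w • onY n f = onX n (onX (n + 1) f v) w - onX n (onX (n + 1) f w) v := by
  cases n with
  | zero => exact hf.2.1 v w
  | succ n => exact hf.2.2.1 v w

/-- The identity for `[v, y] = 0` gives `[[f, y], v] = [[f, v], y]`, which is `0` by induction. So
`[f, y]` annihilates `X`; being itself in a lower prolongation, it also annihilates `y`, in degree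
`0` because it is a derivation and `σ ≠ 0`. -/
theorem tanaka_onY_eq_zero (hg : ∀ φ z, IsFirstProlong σ g φ z → z = 0)
    (hσ : ∃ v w, σ v w ≠ 0) {n : ℕ} {f : ambient X (n + 2)} (hf : f ∈ tanaka σ g (n + 1)) :
    onY n f = 0 := by
  induction n using Nat.strong_induction_on with
  | _ n ih =>
    rcases n with _ | n
    · exact hg _ _ (isFirstProlong_of_mem_tanaka hf)
    · have h1 : ∀ v, onX n (onY (n + 1) f) v = 0 := by
        intro v
        have h2 := hf.2.2.2 v
        rw [ih n (by omega) (tanaka_onX_mem hf v), zero_sub] at h2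
        exact neg_eq_zero.1 h2.symm
      have h0 : onY (n + 1) f ∈ tanaka σ g n := hf.2.1
      rcases n with _ | n
      · refine ambient_one_ext h1 ?_
        obtain ⟨v, w, hvw⟩ := hσ
        have h3 := h0.2 v w
        rw [h1, h1, map_zero, map_zero, LinearMap.zero_apply, map_zero, add_zero] at h3
        exact (mul_eq_zero.1 h3).resolve_left hvw
      · exact ambient_ext h1 (ih n (by omega) h0)

theorem tanaka_isSymmetricElement (halt : σ.IsAlt)
    (hg : ∀ φ z, IsFirstProlong σ g φ z → z = 0) (hσ : ∃ v w, σ v w ≠ 0) {n : ℕ}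
    {f : ambient X (n + 2)} (hf : f ∈ tanaka σ g (n + 1)) : IsSymmetricElement σ (n + 2) f := by
  have hcomm : ∀ {n : ℕ} {f : ambient X (n + 2)}, f ∈ tanaka σ g (n + 1) → ∀ v w,
      onX n (onX (n + 1) f v) w = onX n (onX (n + 1) f w) v := by
    intro n f hf v w
    have h := tanaka_comm hf v w
    rw [tanaka_onY_eq_zero hg hσ hf, smul_zero] at h
    exact sub_eq_zero.1 h.symm
  induction n with
  | zero =>
    refine ⟨fun u v w => ?_, hcomm hf⟩
    have hφ := isFirstProlong_of_mem_tanaka hf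
    have h := hφ.conformal u v w
    rw [hg _ _ hφ, map_zero, neg_zero, zero_mul] at h
    have h2 := LinearMap.IsAlt.neg halt ((onX 0 ∘ₗ onX 1 f) u v) w
    exact h2.symm.trans (neg_eq_of_add_eq_zero_right h)
  | succ n ih => exact ⟨fun v => ih (tanaka_onX_mem hf v), hcomm hf⟩

theorem tanaka_eq_zero_of_form (hnd : σ.Nondegenerate) (halt : σ.IsAlt)
    (hg : ∀ φ z, IsFirstProlong σ g φ z → z = 0) (hσ : ∃ v w, σ v w ≠ 0) {n : ℕ}
    {f : ambient X (n + 2)} (hf : f ∈ tanaka σ g (n + 1))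
    (h : ∀ v, tanakaForm σ (n + 2) f (fun _ => v) = 0) : f = 0 := by
  induction n with
  | zero =>
    have hs := tanaka_isSymmetricElement halt hg hσ hf
    refine ambient_ext (fun w => ?_) (tanaka_onY_eq_zero hg hσ hf)
    refine ambient_one_ext (fun u => ?_) ?_
    · exact hnd.2 _ ((hs.onX w).tanakaForm_onX_const (hs.tanakaForm_onX_const h w) u)
    · have h1 := hf.2.2 w
      have h2 : asVector (onY 0 f) = 0 := tanaka_onY_eq_zero hg hσ hf
      rw [h2, map_zero, add_zero] at h1
      exact h1.symm
  | succ n ih =>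
    have hs := tanaka_isSymmetricElement halt hg hσ hf
    exact ambient_ext (fun w => ih (tanaka_onX_mem hf w) (hs.tanakaForm_onX_const h w))
      (tanaka_onY_eq_zero hg hσ hf)

/-- After `n` brackets the element is in the first prolongation, and the form reduces to the
quadratic equation at `u`. -/
theorem tanakaForm_eq_zero_of_last {u : X}
    (hu : ∀ f ∈ tanaka σ g 1, ∀ w, σ u (asVector (onX 0 (onX 1 f w) u)) = 0) {n : ℕ}
    {f : ambient X (n + 2)} (hf : f ∈ tanaka σ g (n + 1)) (x : Fin (n + 3) → X)
    (h1 : x (Fin.last (n + 2)) = u) (h2 : x (Fin.last (n + 1)).castSucc = u) :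
    tanakaForm σ (n + 2) f x = 0 := by
  induction n with
  | zero =>
    have h : tanakaForm σ 2 f x =
        σ (x (Fin.last 2)) (asVector (onX 0 (onX 1 f (x 0)) (x (Fin.last 1).castSucc))) := rfl
    rw [h, h1, h2]
    exact hu f hf _
  | succ n ih =>
    rw [tanakaForm_succ]
    exact ih (tanaka_onX_mem hf _) _ h1 h2

/-- The form of an element of positive degree vanishes on the span of `n + 2` vectors which
satisfy the quadratic equations given by the values of the first prolongation. -/
theorem tanakaForm_eq_zero_of_sum (halt : σ.IsAlt)
    (hg : ∀ φ z, IsFirstProlong σ g φ z → z = 0) (hσ : ∃ v w, σ v w ≠ 0) {n : ℕ}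
    {f : ambient X (n + 2)} (hf : f ∈ tanaka σ g (n + 1)) (u : Fin (n + 2) → X)
    (hu : ∀ j, ∀ f ∈ tanaka σ g 1, ∀ w, σ (u j) (asVector (onX 0 (onX 1 f w) (u j))) = 0)
    (c : Fin (n + 2) → ℝ) : tanakaForm σ (n + 2) f (fun _ => ∑ j, c j • u j) = 0 := by
  classical
  have hs := tanaka_isSymmetricElement halt hg hσ hf
  have h := (tanakaForm σ (n + 2) f).map_sum (fun (_ : Fin (n + 3)) j => c j • u j)
  refine h.trans (Finset.sum_eq_zero fun r _ => ?_)
  have h' := (tanakaForm σ (n + 2) f).map_smul_univ (fun i => c (r i)) (fun i => u (r i))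
  refine h'.trans ?_
  -- Pigeonhole: `n + 3` arguments are taken from `n + 2` vectors. This fixes the order of the
  -- secant variety.
  obtain ⟨i, j, hij, hr⟩ := Fintype.exists_ne_map_eq_of_card_lt r (by simp)
  rw [hs.tanakaForm_eq_zero_of_eq (tanakaForm_eq_zero_of_last (hu (r i)) hf) hij rfl
    (by simp only [hr]), smul_zero]

end Tanaka

/-! ### Homogeneous polynomials and secant varieties filling the projective space -/

section Secants

variable {X : Type u} [AddCommGroup X] [Module ℝ X]

theorem finiteDimensional_homPoly [FiniteDimensional ℝ X] (n : ℕ) :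
    FiniteDimensional ℝ (homPoly X n) := by
  let L : MultilinearMap ℝ (fun _ : Fin n => X) ℝ →ₗ[ℝ] (X → ℝ) :=
    { toFun := fun m v => m fun _ => v
      map_add' := fun _ _ => rfl
      map_smul' := fun _ _ => rfl }
  have h : homPoly X n ≤ LinearMap.range L := by
    rintro F ⟨m, hm⟩
    exact ⟨m, (funext hm).symm⟩
  exact Submodule.finiteDimensional_of_le h

theorem finiteDimensional_vanishingForms [FiniteDimensional ℝ X] (n : ℕ)
    (E : Set (Projectivization ℝ X)) : FiniteDimensional ℝ (vanishingForms n E) := by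
  have := finiteDimensional_homPoly (X := X) n
  exact Submodule.finiteDimensional_of_le (S₂ := homPoly X n) fun F hF => hF.1

theorem tanakaForm_mem_homPoly {σ : LinearMap.BilinForm ℝ X} (n : ℕ) (f : ambient X n) :
    (fun v => tanakaForm σ n f fun _ => v) ∈ homPoly X (n + 1) :=
  ⟨tanakaForm σ n f, fun _ => rfl⟩

theorem Projectivization.rep_mem_submodule (p : Projectivization ℝ X) : p.rep ∈ p.submodule := by
  rw [p.submodule_eq]
  exact Submodule.mem_span_singleton_self _

theorem secantVariety_eq_univ {E : Set (Projectivization ℝ X)} [FiniteDimensional ℝ X]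
    (hE : Submodule.span ℝ {u : X | ∃ h : u ≠ 0, Projectivization.mk ℝ u h ∈ E} = ⊤) {k : ℕ}
    (hk : Module.finrank ℝ X ≤ k + 1) : secantVariety k E = Set.univ := by
  refine Set.eq_univ_of_forall fun p n F _ hF => hF p ?_
  obtain ⟨m, hmk, f, hf, hspan⟩ : ∃ m ≤ k + 1, ∃ f : Fin m → X,
      (∀ j, ∃ h : f j ≠ 0, Projectivization.mk ℝ (f j) h ∈ E) ∧
      Submodule.span ℝ (Set.range f) = ⊤ := by
    obtain ⟨f, hf, hspan, -⟩ := Submodule.exists_fun_fin_finrank_span_eq ℝ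
      {u : X | ∃ h : u ≠ 0, Projectivization.mk ℝ u h ∈ E}
    exact ⟨_, (Submodule.finrank_le _).trans hk, f, hf, hspan.trans hE⟩
  choose h0 hfE using hf
  have hm0 : 0 < m := by
    by_contra h
    have : IsEmpty (Fin m) := by
      rw [Nat.eq_zero_of_not_pos h]
      infer_instance
    rw [Set.range_eq_empty, Submodule.span_empty] at hspan
    refine p.rep_nonzero ?_
    have h1 : p.rep ∈ (⊥ : Submodule ℝ X) := hspan ▸ Submodule.mem_top
    exact (Submodule.mem_bot ℝ).1 h1
  -- The `m ≤ k + 1` spanning points are padded to `k + 1` by repeating the first one, which exists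
  -- because `X ≠ 0`.
  refine ⟨fun j => if h : (j : ℕ) < m then Projectivization.mk ℝ (f ⟨j, h⟩) (h0 _)
    else Projectivization.mk ℝ (f ⟨0, hm0⟩) (h0 _), fun j => ?_, ?_⟩
  · by_cases h : (j : ℕ) < m
    · simpa only [h, dif_pos] using hfE _
    · simpa only [h, dif_neg, not_false_eq_true] using hfE _
  · refine le_top.trans (hspan.ge.trans (Submodule.span_le.2 ?_))
    rintro _ ⟨i, rfl⟩
    refine Submodule.mem_iSup_of_mem (⟨i, by omega⟩ : Fin (k + 1)) ?_
    simp only [i.2, dif_pos, Projectivization.submodule_mk]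
    exact Submodule.mem_span_singleton_self _

end Secants

/-! ### The varieties `𝓔_i` and the main theorem -/

section Main

variable {X : Type u} [AddCommGroup X] [Module ℝ X] {σ : LinearMap.BilinForm ℝ X}
  {G : ℤ → Submodule ℝ X} {δ : Submodule ℝ (Module.End ℝ X)} {D : JacobiDiagram}

namespace SkewTableau

theorem finiteDimensional (T : SkewTableau D σ G δ) : FiniteDimensional ℝ X :=
  Module.Finite.of_basis T.basis

theorem positivePart_le_frakL (T : SkewTableau D σ G δ) (i : Fin D.r ⊕ Fin D.t) :
    positivePart G ≤ T.frakL i := by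
  rcases i with i | i
  · rw [frakL]
    split_ifs
    · exact le_rfl
    · exact le_sup_left
  · exact le_rfl

theorem exists_σ_ne_zero (hX : IsGradedSymplectic σ G) (T : SkewTableau D σ G δ)
    (i : Fin D.r ⊕ Fin D.t) : ∃ v w, σ v w ≠ 0 := by
  by_contra! h
  have : ∃ a : D.Row, True := by
    rcases i with i | i
    · exact ⟨.inl (.inl i), trivial⟩
    · exact ⟨.inr i, trivial⟩
  obtain ⟨a, -⟩ := this
  exact T.basis.ne_zero ⟨a, ⟨0, D.len_pos a⟩⟩ (hX.nondegenerate.2 _ fun v => h v _)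

/-- The equation is a homogeneous quadratic polynomial vanishing on the translates of `𝔏_i`, so it
passes to their Zariski closure. -/
theorem quadric_orbitVariety (T : SkewTableau D σ G δ) (hX : IsGradedSymplectic σ G)
    (h1 : D.Cond1) (h3 : D.Cond3) (h4 : D.Cond4) {i : Fin D.r ⊕ Fin D.t}
    {q : Projectivization ℝ X} (hq : q ∈ T.orbitVariety i) {f : ambient X 2}
    (hf : f ∈ tanaka σ (uF σ G δ) 1) (w : X) :
    σ q.rep (asVector (onX 0 (onX 1 f w) q.rep)) = 0 := by
  refine hq 2 _ (tanakaForm_mem_homPoly (σ := σ) 1 (onX 1 f w)) fun p hp => ?_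
  obtain ⟨x, hx, hp⟩ := hp
  obtain ⟨u, hu, hup⟩ := hp p.rep_mem_submodule
  have h := (T.firstProlong_main hX h1 h3 h4 (isFirstProlong_of_mem_tanaka hf)).2 i x hx u hu w
  rw [hup] at h
  exact h

theorem span_orbitVariety (T : SkewTableau D σ G δ) (h1 : D.Cond1) (i : Fin D.r ⊕ Fin D.t) :
    Submodule.span ℝ {u : X | ∃ h : u ≠ 0, Projectivization.mk ℝ u h ∈ T.orbitVariety i} = ⊤ := by
  refine T.eq_top_of_forall_expNilpotent h1 fun x hx u hu => ?_
  by_cases h : expNilpotent x u = 0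
  · rw [h]
    exact Submodule.zero_mem _
  · refine Submodule.subset_span ⟨h, fun n F _ hF => hF _ ⟨x, hx, ?_⟩⟩
    rw [Projectivization.submodule_mk, Submodule.span_singleton_le_iff_mem]
    exact ⟨u, T.positivePart_le_frakL i hu, rfl⟩

theorem tanakaForm_mem_vanishingForms (T : SkewTableau D σ G δ) (hX : IsGradedSymplectic σ G)
    (h1 : D.Cond1) (h3 : D.Cond3) (h4 : D.Cond4) (i : Fin D.r ⊕ Fin D.t) {n : ℕ}
    {f : ambient X (n + 2)} (hf : f ∈ tanaka σ (uF σ G δ) (n + 1)) :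
    (fun v => tanakaForm σ (n + 2) f fun _ => v) ∈
      vanishingForms (n + 3) (secantVariety (n + 1) (T.orbitVariety i)) := by
  have hP := tanakaForm_mem_homPoly (σ := σ) (n + 2) f
  refine ⟨hP, fun p hp => hp _ _ hP ?_⟩
  rintro p ⟨q, hq, hpq⟩
  have hmem := hpq p.rep_mem_submodule
  have e : ⨆ j, (q j).submodule = Submodule.span ℝ (Set.range fun j => (q j).rep) := by
    rw [Submodule.span_range_eq_iSup]
    exact iSup_congr fun j => (q j).submodule_eq
  rw [e, Submodule.mem_span_range_iff_exists_fun] at hmem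
  obtain ⟨c, hc⟩ := hmem
  simp only [← hc]
  exact tanakaForm_eq_zero_of_sum hX.alt
    (fun φ z hφ => (T.firstProlong_main hX h1 h3 h4 hφ).1) (T.exists_σ_ne_zero hX i) hf _
    (fun j f hf w => T.quadric_orbitVariety hX h1 h3 h4 (hq j) hf w) c

end SkewTableau

end Main

theorem mainTheorem5 {X : Type u} [AddCommGroup X] [Module ℝ X]
    (σ : LinearMap.BilinForm ℝ X) (G : ℤ → Submodule ℝ X) (hX : IsGradedSymplectic σ G)
    (δ : Submodule ℝ (Module.End ℝ X)) (D : JacobiDiagram) (T : SkewTableau D σ G δ)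
    (h1 : D.Cond1) (h2 : D.Cond2) (h3 : D.Cond3) (h4 : D.Cond4)
    (i : Fin D.r ⊕ Fin D.t) :
    (∀ k : ℕ, 1 ≤ k →
      (∃ ι : tanaka σ (uF σ G δ) k →ₗ[ℝ]
          vanishingForms (k + 2) (secantVariety k (T.orbitVariety i)),
        Function.Injective ι ∧
        ∀ (f : tanaka σ (uF σ G δ) k) (v : X),
          (ι f : X → ℝ) v = σ v (diagonal (k + 1) (f : ambient X (k + 1)) v)) ∧
      FiniteDimensional ℝ (vanishingForms (k + 2) (secantVariety k (T.orbitVariety i))) ∧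
      Module.finrank ℝ (tanaka σ (uF σ G δ) k) ≤
        Module.finrank ℝ (vanishingForms (k + 2) (secantVariety k (T.orbitVariety i)))) ∧
    ∃ K : ℕ, ∀ k : ℕ, K ≤ k →
      secantVariety k (T.orbitVariety i) = Set.univ ∧ tanaka σ (uF σ G δ) k = ⊥ := by
  have hfd := T.finiteDimensional
  have hinj : ∀ {n : ℕ} {f : ambient X (n + 2)}, f ∈ tanaka σ (uF σ G δ) (n + 1) →
      (∀ v, tanakaForm σ (n + 2) f (fun _ => v) = 0) → f = 0 := fun hf h =>
    tanaka_eq_zero_of_form hX.nondegenerate hX.alt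
      (fun φ z hφ => (T.firstProlong_main hX h1 h3 h4 hφ).1) (T.exists_σ_ne_zero hX i) hf h
  constructor
  · intro k hk
    obtain ⟨n, rfl⟩ : ∃ n, k = n + 1 := ⟨k - 1, by omega⟩
    have hdim := finiteDimensional_vanishingForms (n + 1 + 2)
      (secantVariety (n + 1) (T.orbitVariety i))
    have hι : ∃ ι : tanaka σ (uF σ G δ) (n + 1) →ₗ[ℝ]
          vanishingForms (n + 1 + 2) (secantVariety (n + 1) (T.orbitVariety i)),
        Function.Injective ι ∧
        ∀ (f : tanaka σ (uF σ G δ) (n + 1)) (v : X),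
          (ι f : X → ℝ) v = σ v (diagonal (n + 1 + 1) (f : ambient X (n + 1 + 1)) v) := by
      let ι : tanaka σ (uF σ G δ) (n + 1) →ₗ[ℝ]
          vanishingForms (n + 1 + 2) (secantVariety (n + 1) (T.orbitVariety i)) :=
        { toFun := fun f => ⟨fun v => tanakaForm σ (n + 2) f.1 fun _ => v,
            T.tanakaForm_mem_vanishingForms hX h1 h3 h4 i f.2⟩
          map_add' := fun f f' => by
            ext v
            simp
          map_smul' := fun c f => by
            ext v
            simp }
      refine ⟨ι, (injective_iff_map_eq_zero ι).2 fun f hf => ?_, fun f v =>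
        tanakaForm_const (n + 2) f.1 v⟩
      refine Subtype.ext (hinj f.2 fun v => ?_)
      exact congrFun (congrArg Subtype.val hf) v
    refine ⟨hι, hdim, ?_⟩
    obtain ⟨ι, hinj, -⟩ := hι
    exact LinearMap.finrank_le_finrank_of_injective hinj
  -- Not sharp; the summand `1` guarantees `k ≥ 1`, where the forms are available.
  · refine ⟨Module.finrank ℝ X + 1, fun k hk => ?_⟩
    have huniv := secantVariety_eq_univ (T.span_orbitVariety h1 i) (k := k) (by omega)
    refine ⟨huniv, (Submodule.eq_bot_iff _).2 ?_⟩
    obtain ⟨n, rfl⟩ : ∃ n, k = n + 1 := ⟨k - 1, by omega⟩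
    intro f hf
    refine hinj hf fun v => ?_
    obtain ⟨m, hm⟩ := (T.tanakaForm_mem_vanishingForms hX h1 h3 h4 i hf).1
    have hvan := (T.tanakaForm_mem_vanishingForms hX h1 h3 h4 i hf).2
    rw [huniv] at hvan
    by_cases hv : v = 0
    · exact (tanakaForm σ (n + 2) f).map_coord_zero 0 hv
    · obtain ⟨a, ha⟩ := Projectivization.exists_smul_eq_mk_rep ℝ v hv
      have h := hvan (Projectivization.mk ℝ v hv) (Set.mem_univ _)
      rw [← ha] at h
      have h' := (tanakaForm σ (n + 2) f).map_smul_univ (fun _ => (a : ℝ)) (fun _ => v)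
      have h'' := h'.symm.trans h
      rw [smul_eq_mul] at h''
      refine (mul_eq_zero.1 h'').resolve_left ?_
      simp
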